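/- Setting. Let $\mathcal X$ be a measurable space with a topology, $\rho$ a probability measure on $\mathcal X\times\{-1,1\}$ with marginal $\rho_{\mathcal X}$ and conditional probability $\rho(1|x)$, and $\mathcal H_k$ the reproducing kernel Hilbert space of a measurable real-valued kernel $k$ on $\mathcal X$. Let $\phi:\mathbb R\to[0,\infty)$ be convex, $l(\zeta,y)=\phi(y\zeta)$, $\mathcal L(g)=\mathbb E[l(g(X),Y)]$, $\mathcal L_\lambda(g)=\mathcal L(g)+\frac\lambda2\|g\|_{\mathcal H_k}^2$, and let $\mathcal R(g)=\mathbb P[\mathrm{sgn}(g(X))\ne Y]$ be the expected classification error, where $(X,Y)\sim\rho$ and $\mathrm{sgn}(0)=0$. Put $h_*(\mu)=\arg\min_{h\in\mathbb R}\{\mu\phi(h)+(1-\mu)\phi(-h)\}$ and $l_*(\mu)=\min_{h\in\mathbb R}\{\mu\phi(h)+(1-\mu)\phi(-h)\}$ for $\mu\in(0,1)$, $d_{l_*}(\eta_1,\eta_2)=-l_*(\eta_2)+l_*(\eta_1)+l_*'(\eta_1)(\eta_2-\eta_1)$, and $m(\delta)=\max\{h_*(\tfrac12+\delta),|h_*(\tfrac12-\delta)|\}$.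 Assumptions. (A1) $\phi$ is differentiable; there is $M>0$ with $|\partial_\zeta l(\zeta,y)|\le M$ for all $\zeta,y$; there is $L>0$ with $|\mathcal L(g+h)-\mathcal L(g)-\langle\nabla\mathcal L(g),h\rangle_{\mathcal H_k}|\le\frac L2\|h\|_{\mathcal H_k}^2$ for all $g,h\in\mathcal H_k$. (A2) $\mathrm{supp}(\rho_{\mathcal X})=\mathcal X$, and there is $R>0$ with $k(x,x)\le R^2$ for all $x$. (A3) There is $\delta\in(0,\tfrac12)$ with $|\rho(1|X)-\tfrac12|>\delta$ $\rho_{\mathcal X}$-almost surely. (A4) $\rho(1|X)\in(0,1)$ $\rho_{\mathcal X}$-almost surely; on $(0,1)$ the function $h_*$ is well defined (the minimizer exists and is unique), differentiable, monotonically increasing and injective, and $\mathrm{sgn}(\mu-\tfrac12)=\mathrm{sgn}(h_*(\mu))$. (A5) For $\eta_1,\eta_2\in(0,1)$, $d_{l_*}(\eta_1,\eta_2)=0$ if and only if $\eta_1=\eta_2$; and $\mathcal H_k$ contains a minimizer of $\mathcal L$ over all measurable functions, which is unique up to $\rho_{\mathcal X}$-null sets. Theorem. Under (A1)–(A5) there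 is $\lambda_0>0$ such that for every $\lambda\in(0,\lambda_0]$ the functional $\mathcal L_\lambda$ has a minimizer $g_\lambda$ in $\mathcal H_k$ and the following holds. Let $\gamma>0$ and $\eta_t=\frac{2}{\lambda(\gamma+t)}$ with $\eta_1\le\min\{\frac1{L+\lambda},\frac1{2\lambda}\}$; let $\sigma>0$ be such that the variance of the stochastic gradient, $\mathbb E\|\partial_\zeta l(g(X),Y)k(X,\cdot)-\nabla\mathcal L(g)\|_{\mathcal H_k}^2$, is at most $\sigma^2$ for every $g\in\mathcal H_k$; let $g_1\in\mathcal H_k$ with $\|g_1\|_{\mathcal H_k}\le(2\eta_1+\frac1\lambda)MR$; and let $(x_t,y_t)_{t\ge1}$ be independent samples from $\rho$. Define the iterates of stochastic gradient descent by $$g_{t+1}=g_t-\eta_t\bigl(\partial_\zeta l(g_t(x_t),y_t)\,k(x_t,\cdot)+\lambda g_t\bigr),$$ and put $$\nu=\max\Bigl\{\tfrac{2}{\lambda^2}(L+\lambda)\sigma^2,\ (1+\gamma)\bigl(\mathcal L_\lambda(g_1)-\mathcal L_\lambda(g_\lambda)\bigr)\Bigr\}.$$ Then for every integer $T\ge0$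 with $T\ge\frac{32R^2\nu}{m(\delta)^2\lambda}-\gamma$, $$\mathbb E\bigl[\mathcal R(g_{T+1})-\mathcal R(\mathbb E[Y|x])\bigr]\le 2\exp\Bigl(-\frac{m(\delta)^2\lambda^2(\gamma+T)}{2^9\cdot 9\,M^2R^4}\Bigr),$$ where $\mathbb E[Y|x]=2\rho(1|x)-1$ is the Bayes classifier. -/

import Mathlib

open MeasureTheory ProbabilityTheory Set
open scoped InnerProductSpace

/-! Labels are elements of `ℤˣ = {-1, 1}`. -/

instance instMeasurableSingletonClassIntUnits : MeasurableSingletonClass ℤˣ :=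
  ⟨fun y => ⟨{(y : ℤ)}, measurableSet_singleton _, by
    ext u; simp [Units.ext_iff]⟩⟩

namespace KernelSGD

noncomputable section

/-! ### Real-valued notions attached to `φ : ℝ → ℝ` -/

/-- A label as a real number. -/
def lab (y : ℤˣ) : ℝ := ((y : ℤ) : ℝ)

/-- The loss `l(ζ, y) = φ(y ζ)`. -/
def loss (φ : ℝ → ℝ) (ζ : ℝ) (y : ℤˣ) : ℝ := φ (lab y * ζ)

/-- The partial derivative `∂_ζ l(ζ, y)` in the first variable. -/
def lossDeriv (φ : ℝ → ℝ) (ζ : ℝ) (y : ℤˣ) : ℝ := deriv (fun u => loss φ u y) ζ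

/-- The conditional risk `μ φ(h) + (1 - μ) φ(-h)`. -/
def condRisk (φ : ℝ → ℝ) (μ h : ℝ) : ℝ := μ * φ h + (1 - μ) * φ (-h)

/-- `h` minimizes the conditional risk at `μ`. -/
def IsCondMin (φ : ℝ → ℝ) (μ h : ℝ) : Prop := ∀ h' : ℝ, condRisk φ μ h ≤ condRisk φ μ h'

/-- The link function `h_*` is well defined on `(0, 1)`: the minimizer exists and is unique. -/
def LinkWellDefined (φ : ℝ → ℝ) : Prop := ∀ μ ∈ Ioo (0 : ℝ) 1, ∃! h : ℝ, IsCondMin φ μ h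

/-- The link function `h_*(μ) = argmin_h (μ φ(h) + (1 - μ) φ(-h))`. -/
def link (φ : ℝ → ℝ) (μ : ℝ) : ℝ := Classical.epsilon (IsCondMin φ μ)

/-- `l_*(μ)`, the minimal value of the conditional risk. -/
def lStar (φ : ℝ → ℝ) (μ : ℝ) : ℝ := ⨅ h : ℝ, condRisk φ μ h

/-- The Bregman divergence of the concave function `l_*`. -/
def bregman (φ : ℝ → ℝ) (η₁ η₂ : ℝ) : ℝ :=
  -lStar φ η₂ + lStar φ η₁ + deriv (lStar φ) η₁ * (η₂ - η₁)

/-- `m(δ) = max {h_*(1/2 + δ), |h_*(1/2 - δ)|}`. -/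
def margin (φ : ℝ → ℝ) (δ : ℝ) : ℝ := max (link φ (1 / 2 + δ)) |link φ (1 / 2 - δ)|

/-! ### The classification problem -/

section Problem

variable {X : Type*} [MeasurableSpace X]

/-- The conditional probability `ρ(1 | x)` of the label `1` given `x`. -/
def condProb (ρ : Measure (X × ℤˣ)) [IsFiniteMeasure ρ] (x : X) : ℝ := (ρ.condKernel x).real {1}

/-- The Bayes classifier `𝔼[Y | x] = 2 ρ(1 | x) - 1`. -/
def bayesClassifier (ρ : Measure (X × ℤˣ)) [IsFiniteMeasure ρ] (x : X) : ℝ := 2 * condProb ρ x - 1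

open Classical in
/-- The 0-1 error function. -/
def zeroOne (a b : ℝ) : ℝ := if a = b then 0 else 1

/-- The expected classification error `𝓡(g) = 𝔼[I(sgn(g(X)), Y)]`, where `sgn 0 = 0`. -/
def classError (ρ : Measure (X × ℤˣ)) (g : X → ℝ) : ℝ :=
  ∫ z, zeroOne (Real.sign (g z.1)) (lab z.2) ∂ρ

/-- The expected risk `𝓛(g) = 𝔼[l(g(X), Y)]`. -/
def risk (φ : ℝ → ℝ) (ρ : Measure (X × ℤˣ)) (g : X → ℝ) : ℝ := ∫ z, loss φ (g z.1) z.2 ∂ρ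

/-- `g` has finite expected risk. -/
def FiniteRisk (φ : ℝ → ℝ) (ρ : Measure (X × ℤˣ)) (g : X → ℝ) : Prop :=
  Integrable (fun z : X × ℤˣ => loss φ (g z.1) z.2) ρ

/-- `g` minimizes the expected risk over all measurable functions. For nonnegative `φ`, a measurable
function that does not satisfy `FiniteRisk` has risk `+∞`, hence it is no competitor. -/
def IsBayesRule (φ : ℝ → ℝ) (ρ : Measure (X × ℤˣ)) (g : X → ℝ) : Prop :=
  Measurable g ∧ FiniteRisk φ ρ g ∧
    ∀ f : X → ℝ, Measurable f → FiniteRisk φ ρ f → risk φ ρ g ≤ risk φ ρ f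

end Problem

/-! ### The reproducing kernel Hilbert space and stochastic gradient descent -/

section SGD

variable {X : Type*} (H : Type*) [NormedAddCommGroup H] [InnerProductSpace ℝ H] [CompleteSpace H]
  [RKHS ℝ H X ℝ]

/-- The reproducing kernel `k(x, x')` of `H`. -/
def ker (x x' : X) : ℝ := RKHS.kernel H x x' 1

/-- The function `k(x, ·)` as an element of `H`. -/
def feature (x : X) : H := RKHS.kerFun H x 1

variable {H} [MeasurableSpace X]

/-- The expected risk as a functional on `H`. -/
def riskH (φ : ℝ → ℝ) (ρ : Measure (X × ℤˣ)) (g : H) : ℝ := risk φ ρ g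

/-- The regularized expected risk `𝓛_λ(g) = 𝓛(g) + (λ/2) ‖g‖²`. -/
def regRisk (φ : ℝ → ℝ) (ρ : Measure (X × ℤˣ)) (lam : ℝ) (g : H) : ℝ :=
  riskH φ ρ g + lam / 2 * ‖g‖ ^ 2

/-- The stochastic gradient `∂_ζ l(g(x), y) k(x, ·)` of `𝓛` at `g` for the sample `z = (x, y)`. -/
def stochGrad (φ : ℝ → ℝ) (g : H) (z : X × ℤˣ) : H := lossDeriv φ (g z.1) z.2 • feature H z.1

/-- The stochastic gradient `G_λ(g, z)` of `𝓛_λ`. -/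
def regStochGrad (φ : ℝ → ℝ) (lam : ℝ) (g : H) (z : X × ℤˣ) : H := stochGrad φ g z + lam • g

/-- The variance of the stochastic gradient of `𝓛` at `g` (whose mean is `∇𝓛(g)`). -/
def gradVariance (φ : ℝ → ℝ) (ρ : Measure (X × ℤˣ)) (g : H) : ℝ :=
  ∫ z, ‖stochGrad φ g z - gradient (riskH φ ρ) g‖ ^ 2 ∂ρ

/-- The learning rate `η_t = 2 / (λ (γ + t))`. -/
def stepSize (lam γ : ℝ) (t : ℕ) : ℝ := 2 / (lam * (γ + t))

/-- Stochastic gradient descent driven by the samples `z 1, z 2, …`: the value at `n` is the iterate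
`g_{n+1}`, so the value at `0` is the initial function `g₁`. -/
def sgd (φ : ℝ → ℝ) (lam γ : ℝ) (g₁ : H) (z : ℕ → X × ℤˣ) : ℕ → H
  | 0 => g₁
  | n + 1 => sgd φ lam γ g₁ z n -
      stepSize lam γ (n + 1) • regStochGrad φ lam (sgd φ lam γ g₁ z n) (z (n + 1))

/-- The constant `ν`; here `gl` stands for the minimizer `g_λ` of `𝓛_λ`. -/
def nu (φ : ℝ → ℝ) (ρ : Measure (X × ℤˣ)) (lam γ L σ : ℝ) (g₁ gl : H) : ℝ :=
  max (2 / lam ^ 2 * (L + lam) * σ ^ 2) ((1 + γ) * (regRisk φ ρ lam g₁ - regRisk φ ρ lam gl))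

end SGD

end

end KernelSGD

/-!
By strong convexity the minimizers `g_λ` of the regularized risk converge in `H`, as `λ → 0`, to a
minimizer of the risk, that is, to a Bayes rule `g₀`. Since `g₀ = h_*(ρ(1 | ·))` almost everywhere,
the low-noise condition keeps `|g₀|` above the margin `m`, and the reproducing property turns a
distance below `m / R` in `H` into a distance below `m` everywhere. So for small `λ` every function
within `m / (2R)` of `g_λ` classifies like the Bayes rule.

It remains to bound the probability that `g_{T+1}` is at distance at least `m / (2R)` from `g_λ`.
One gradient step contracts the distance to `g_λ` by `1 - ηλ` and adds a centered perturbation of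
norm at most `2ηMR`. As `s ↦ cosh √s` is convex, conditional expectations satisfy
`E cosh(θ ‖v + ξ‖) ≤ cosh(θ ‖v‖) cosh(θ c)` for such a perturbation `ξ` with `‖ξ‖ ≤ c`, and
`cosh x ≤ exp(x² / 2)`. Iterated along the step sizes `2 / (λ(γ + t))` this yields a sub-Gaussian
distance with bias `γ / (γ + T) ‖g₁ - g_λ‖` and variance proxy `(4MR / λ)² / (γ + T)`.
-/

namespace KernelSGD

section Convex

open Filter Topology

variable {H : Type*} [NormedAddCommGroup H] {F : H → ℝ} {G : H → H} {L lam mu : ℝ} {g h : H}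

/-- `g` minimizes `F + (λ/2) ‖·‖²` with the quadratic growth that `λ`-strong convexity provides.
For `λ = 0` it is just a minimizer of `F`. -/
def IsRegularizedMin (F : H → ℝ) (lam : ℝ) (g : H) : Prop :=
  ∀ h, F g + lam / 2 * ‖g‖ ^ 2 + lam / 2 * ‖h - g‖ ^ 2 ≤ F h + lam / 2 * ‖h‖ ^ 2

theorem isRegularizedMin_zero_iff : IsRegularizedMin F 0 g ↔ ∀ h, F g ≤ F h := by
  simp [IsRegularizedMin]

namespace IsRegularizedMin

theorem le (hg : IsRegularizedMin F lam g) (hlam : 0 ≤ lam) (h : H) :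
    F g + lam / 2 * ‖g‖ ^ 2 ≤ F h + lam / 2 * ‖h‖ ^ 2 :=
  (le_add_of_nonneg_right (by positivity)).trans (hg h)

theorem norm_sub_sq_le (hg : IsRegularizedMin F lam g) (hh : IsRegularizedMin F mu h)
    (hlam : 0 ≤ lam) (hlt : lam < mu) : ‖g - h‖ ^ 2 ≤ ‖g‖ ^ 2 - ‖h‖ ^ 2 := by
  have hgh := hg h
  have hhg := hh g
  rw [norm_sub_rev h g] at hgh
  have hsum : (mu - lam) / 2 * ‖g - h‖ ^ 2 + lam * ‖g - h‖ ^ 2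
      ≤ (mu - lam) / 2 * (‖g‖ ^ 2 - ‖h‖ ^ 2) := by linarith
  exact le_of_mul_le_mul_left ((le_add_of_nonneg_right (by positivity)).trans hsum)
    (half_pos (sub_pos.2 hlt))

end IsRegularizedMin

variable [InnerProductSpace ℝ H]

/-- `G` selects a subgradient of `F` at every point; for `G` the gradient of `F` this is convexity
of `F`. -/
def IsSubgradientField (F : H → ℝ) (G : H → H) : Prop :=
  ∀ g h, F g + ⟪G g, h - g⟫_ℝ ≤ F h

/-- The descent inequality of an `L`-smooth functional `F` with gradient `G`. -/
def HasQuadraticUpperBound (L : ℝ) (F : H → ℝ) (G : H → H) : Prop :=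
  ∀ g h, F h ≤ F g + ⟪G g, h - g⟫_ℝ + L / 2 * ‖h - g‖ ^ 2

theorem HasQuadraticUpperBound.of_abs_le
    (h : ∀ g h, |F (g + h) - F g - ⟪G g, h⟫_ℝ| ≤ L / 2 * ‖h‖ ^ 2) :
    HasQuadraticUpperBound L F G := fun g k => by
  have := (le_abs_self _).trans (h g (k - g))
  rw [add_sub_cancel] at this
  linarith

theorem eq_zero_of_forall_mul_le_mul_sq {d c : ℝ} (h : ∀ t : ℝ, t * d ≤ c * t ^ 2) : d = 0 := by
  have hmin : IsLocalMin (fun t : ℝ => c * t ^ 2 - t * d) 0 :=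
    .of_forall fun t => by simpa using h t
  have hderiv : HasDerivAt (fun t : ℝ => c * t ^ 2 - t * d) (-d) 0 := by
    simpa using ((hasDerivAt_pow 2 (0 : ℝ)).const_mul c).fun_sub ((hasDerivAt_id 0).mul_const d)
  exact neg_eq_zero.1 (hmin.hasDerivAt_eq_zero hderiv)

theorem HasQuadraticUpperBound.inner_eq (hF : HasQuadraticUpperBound L F G) {l : H → ℝ}
    (hsmul : ∀ (t : ℝ) (k : H), l (t • k) = t * l k) (hl : ∀ k, F g + l k ≤ F (g + k)) (k : H) :
    ⟪G g, k⟫_ℝ = l k := by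
  refine (sub_eq_zero.1 (eq_zero_of_forall_mul_le_mul_sq (c := L / 2 * ‖k‖ ^ 2) fun t => ?_)).symm
  have hlower := hl (t • k)
  have hupper := hF g (g + t • k)
  rw [add_sub_cancel_left, inner_smul_right, norm_smul, mul_pow, Real.norm_eq_abs,
    sq_abs] at hupper
  rw [hsmul] at hlower
  linarith

namespace IsSubgradientField

theorem inner_sub_nonneg (hG : IsSubgradientField F G) (g h : H) :
    0 ≤ ⟪G g - G h, g - h⟫_ℝ := by
  have hgh := hG g h
  have hhg := hG h g
  rw [← neg_sub g h, inner_neg_right] at hgh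
  rw [inner_sub_left]
  linarith

theorem add_inner_add_norm_sub_sq_le (hG : IsSubgradientField F G)
    (hF : HasQuadraticUpperBound L F G) (hL : 0 < L) (g h : H) :
    F g + ⟪G g, h - g⟫_ℝ + ‖G h - G g‖ ^ 2 / (2 * L) ≤ F h := by
  set d := G h - G g with hd
  have hstep : F g + ⟪G g, h - L⁻¹ • d - g⟫_ℝ
      ≤ F h + ⟪G h, h - L⁻¹ • d - h⟫_ℝ + L / 2 * ‖h - L⁻¹ • d - h‖ ^ 2 :=
    (hG g _).trans (hF h _)
  have hinner : ⟪G h, d⟫_ℝ - ⟪G g, d⟫_ℝ = ‖d‖ ^ 2 := by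
    rw [← inner_sub_left, ← hd, real_inner_self_eq_norm_sq]
  rw [show h - L⁻¹ • d - g = (h - g) - L⁻¹ • d by abel, show h - L⁻¹ • d - h = -(L⁻¹ • d) by abel,
    inner_sub_right, inner_neg_right, inner_smul_right, inner_smul_right, norm_neg, norm_smul,
    mul_pow, Real.norm_eq_abs, sq_abs] at hstep
  have hquad : L / 2 * (L⁻¹ ^ 2 * ‖d‖ ^ 2) = ‖d‖ ^ 2 / (2 * L) := by field_simp
  have hlin : L⁻¹ * ⟪G h, d⟫_ℝ - L⁻¹ * ⟪G g, d⟫_ℝ = 2 * (‖d‖ ^ 2 / (2 * L)) := by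
    rw [← mul_sub, hinner]; field_simp
  linarith

theorem norm_sub_sq_le_mul_inner (hG : IsSubgradientField F G)
    (hF : HasQuadraticUpperBound L F G) (hL : 0 < L) (g h : H) :
    ‖G g - G h‖ ^ 2 ≤ L * ⟪G g - G h, g - h⟫_ℝ := by
  have hgh := hG.add_inner_add_norm_sub_sq_le hF hL g h
  have hhg := hG.add_inner_add_norm_sub_sq_le hF hL h g
  rw [norm_sub_rev, ← neg_sub g h, inner_neg_right] at hgh
  have hsum : ‖G g - G h‖ ^ 2 / L ≤ ⟪G g - G h, g - h⟫_ℝ := by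
    rw [inner_sub_left, ← add_halves (‖G g - G h‖ ^ 2 / L), div_div, mul_comm L 2]
    linarith
  rwa [div_le_iff₀' hL] at hsum

theorem norm_gradient_step_sub_le (hG : IsSubgradientField F G)
    (hF : HasQuadraticUpperBound L F G) (hL : 0 < L) {η : ℝ} (hη : 0 ≤ η)
    (hηL : η * (L + lam) ≤ 1) (g h : H) :
    ‖(g - η • (G g + lam • g)) - (h - η • (G h + lam • h))‖ ≤ (1 - η * lam) * ‖g - h‖ := by
  set d := G g - G h with hd
  set u := ⟪d, g - h⟫_ℝ with hu
  have hu0 : 0 ≤ u := hG.inner_sub_nonneg g h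
  have hηlam : 0 ≤ 1 - η * lam := by nlinarith
  have hcoco : η ^ 2 * ‖d‖ ^ 2 ≤ η * (1 - η * lam) * u := by
    calc η ^ 2 * ‖d‖ ^ 2 ≤ η ^ 2 * (L * u) := by
          gcongr; exact hG.norm_sub_sq_le_mul_inner hF hL g h
      _ = η * (η * L) * u := by ring
      _ ≤ _ := by gcongr; linarith
  have hcross : 0 ≤ η * (1 - η * lam) * u := by positivity
  have hdecomp : (g - η • (G g + lam • g)) - (h - η • (G h + lam • h))
      = (1 - η * lam) • (g - h) - η • d := by rw [hd]; module
  refine le_of_sq_le_sq ?_ (by positivity)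
  rw [hdecomp, norm_sub_sq_real, norm_smul, norm_smul, real_inner_smul_left,
    real_inner_smul_right, real_inner_comm, ← hu, mul_pow, mul_pow, Real.norm_eq_abs,
    Real.norm_eq_abs, sq_abs, sq_abs, mul_pow]
  linarith

theorem exists_add_smul_eq_zero [CompleteSpace H] (hG : IsSubgradientField F G)
    (hF : HasQuadraticUpperBound L F G) (hL : 0 < L) (hlam : 0 < lam) :
    ∃ g, G g + lam • g = 0 := by
  set η := (L + lam)⁻¹
  have hη0 : 0 < η := by positivity
  have hηL : η * (L + lam) = 1 := inv_mul_cancel₀ (by positivity)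
  have hηlam : 0 < η * lam := by positivity
  have hrate : ((1 - η * lam).toNNReal : ℝ) = 1 - η * lam :=
    Real.coe_toNNReal _ (by nlinarith)
  have hcontr : ContractingWith (1 - η * lam).toNNReal fun g => g - η • (G g + lam • g) := by
    refine ⟨?_, LipschitzWith.of_dist_le_mul fun g h => ?_⟩
    · rw [← NNReal.coe_lt_coe, hrate, NNReal.coe_one]
      linarith
    · rw [dist_eq_norm, dist_eq_norm, hrate]
      exact hG.norm_gradient_step_sub_le hF hL hη0.le hηL.le g h
  have hfix : hcontr.fixedPoint - η • (G hcontr.fixedPoint + lam • hcontr.fixedPoint)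
      = hcontr.fixedPoint := hcontr.fixedPoint_isFixedPt
  exact ⟨hcontr.fixedPoint, (smul_eq_zero.1 (sub_eq_self.1 hfix)).resolve_left hη0.ne'⟩

theorem isRegularizedMin (hG : IsSubgradientField F G) (hg : G g + lam • g = 0) :
    IsRegularizedMin F lam g := by
  intro h
  have hsub := hG g h
  rw [eq_neg_of_add_eq_zero_left hg, inner_neg_left, real_inner_smul_left] at hsub
  have hnorm : ‖h‖ ^ 2 = ‖g‖ ^ 2 + 2 * ⟪g, h - g⟫_ℝ + ‖h - g‖ ^ 2 := by
    rw [← norm_add_sq_real, add_sub_cancel]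
  rw [hnorm]
  linarith

end IsSubgradientField

theorem exists_tendsto_nhdsGT_of_dist_sq_le {E : Type*} [PseudoMetricSpace E] [CompleteSpace E]
    {u : ℝ → E} {f : ℝ → ℝ} {a : ℝ} (hf : BddAbove (f '' Ioi a))
    (hu : ∀ s t, a < s → s < t → dist (u s) (u t) ^ 2 ≤ f s - f t) :
    ∃ x, Tendsto u (𝓝[>] a) (𝓝 x) := by
  have hanti : AntitoneOn f (Ioi a) := fun s hs t _ hst => by
    rcases hst.eq_or_lt with rfl | hlt
    · exact le_rfl
    · exact sub_nonneg.1 ((sq_nonneg _).trans (hu s t hs hlt))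
  have hsymm : ∀ s ∈ Ioi a, ∀ t ∈ Ioi a, dist (u s) (u t) ^ 2 ≤ dist (f s) (f t) := by
    intro s hs t ht
    rcases lt_trichotomy s t with hst | rfl | hts
    · exact (hu s t hs hst).trans (le_abs_self _)
    · simp
    · rw [dist_comm, dist_comm (f s)]
      exact (hu t s ht hts).trans (le_abs_self _)
  refine cauchy_map_iff_exists_tendsto.1 (Metric.cauchy_iff.2 ⟨inferInstance, fun ε hε => ?_⟩)
  obtain ⟨A, hA, hAε⟩ := (Metric.cauchy_iff.1 (hanti.tendsto_nhdsGT hf).cauchy_map).2 (ε ^ 2)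
    (by positivity)
  refine ⟨u '' (f ⁻¹' A ∩ Ioi a), image_mem_map (inter_mem hA self_mem_nhdsWithin), ?_⟩
  rintro _ ⟨s, ⟨hsA, hs⟩, rfl⟩ _ ⟨t, ⟨htA, ht⟩, rfl⟩
  exact lt_of_pow_lt_pow_left₀ 2 hε.le ((hsymm s hs t ht).trans_lt (hAε _ hsA _ htA))

theorem IsSubgradientField.le_of_tendsto (hG : IsSubgradientField F G) {u : ℝ → H} {g₀ : H}
    (hu : ∀ lam, 0 < lam → IsRegularizedMin F lam (u lam)) (hlim : Tendsto u (𝓝[>] 0) (𝓝 g₀))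
    (h : H) : F g₀ ≤ F h := by
  have hbound : Tendsto (fun lam => F h + lam / 2 * ‖h‖ ^ 2 - ⟪G g₀, u lam - g₀⟫_ℝ) (𝓝[>] 0)
      (𝓝 (F h + 0 / 2 * ‖h‖ ^ 2 - ⟪G g₀, g₀ - g₀⟫_ℝ)) :=
    ((((tendsto_nhdsWithin_of_tendsto_nhds tendsto_id).div_const 2).mul_const _).const_add _).sub
      (tendsto_const_nhds.inner (hlim.sub_const _))
  rw [sub_self, inner_zero_right, zero_div, zero_mul, add_zero, sub_zero] at hbound
  refine ge_of_tendsto hbound (eventually_nhdsWithin_of_forall fun lam (hlam : 0 < lam) => ?_)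
  have hsub := hG g₀ (u lam)
  have hmin := (hu lam hlam).le hlam.le h
  have hreg : 0 ≤ lam / 2 * ‖u lam‖ ^ 2 := by positivity
  linarith

theorem IsSubgradientField.exists_tendsto_isRegularizedMin [CompleteSpace H]
    (hG : IsSubgradientField F G) {u : ℝ → H} {gs : H}
    (hu : ∀ lam, 0 < lam → IsRegularizedMin F lam (u lam)) (hgs : ∀ h, F gs ≤ F h) :
    ∃ g₀, Tendsto u (𝓝[>] 0) (𝓝 g₀) ∧ ∀ h, F g₀ ≤ F h := by
  have hbdd : BddAbove ((fun lam => ‖u lam‖ ^ 2) '' Ioi 0) := by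
    refine ⟨‖gs‖ ^ 2, ?_⟩
    rintro _ ⟨lam, hlam, rfl⟩
    exact sub_nonneg.1 ((sq_nonneg _).trans
      ((isRegularizedMin_zero_iff.2 hgs).norm_sub_sq_le (hu lam hlam) le_rfl hlam))
  obtain ⟨g₀, hg₀⟩ := exists_tendsto_nhdsGT_of_dist_sq_le (u := u) hbdd fun s t hs hst => by
    rw [dist_eq_norm]
    exact (hu s hs).norm_sub_sq_le (hu t (hs.trans hst)) hs.le hst
  exact ⟨g₀, hg₀, hG.le_of_tendsto hu hg₀⟩

end Convex

section Concentration

variable {H : Type*} [NormedAddCommGroup H] [InnerProductSpace ℝ H] {Ω : Type*}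
  [MeasurableSpace Ω] {μ : Measure Ω}

theorem convexOn_cosh_sqrt : ConvexOn ℝ (Ici 0) fun s => Real.cosh √s := by
  have hseries : ∀ s : ℝ, 0 ≤ s →
      HasSum (fun n : ℕ => s ^ n / (2 * n).factorial) (Real.cosh √s) := fun s hs => by
    simpa only [pow_mul, Real.sq_sqrt hs] using Real.hasSum_cosh √s
  refine ⟨convex_Ici 0, fun s (hs : 0 ≤ s) t (ht : 0 ≤ t) a b ha hb hab => ?_⟩
  refine hasSum_le (fun n => ?_) (hseries _ (convex_Ici (0 : ℝ) hs ht ha hb hab))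
    (((hseries s hs).mul_left a).add ((hseries t ht).mul_left b))
  rw [← mul_div_assoc, ← mul_div_assoc, ← add_div]
  gcongr
  exact (convexOn_pow n).2 hs ht ha hb hab

theorem exists_cosh_sqrt_le {a c : ℝ} (ha : 0 ≤ a) (hc : 0 ≤ c) :
    ∃ q : ℝ, ∀ p : ℝ, |p| ≤ a * c →
      Real.cosh √(a ^ 2 + c ^ 2 + 2 * p) ≤ Real.cosh a * Real.cosh c + q * p := by
  refine ⟨Real.sinh a * Real.sinh c / (a * c), fun p hp => ?_⟩
  rcases (mul_nonneg ha hc).eq_or_lt with hac | hac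
  · obtain rfl : p = 0 := abs_nonpos_iff.1 (hp.trans hac.ge)
    rcases mul_eq_zero.1 hac.symm with rfl | rfl
    · simp [Real.sqrt_sq hc]
    · simp [Real.sqrt_sq ha]
  obtain ⟨u, rfl⟩ : ∃ u, p = u * (a * c) := ⟨p / (a * c), (div_mul_cancel₀ _ hac.ne').symm⟩
  rw [abs_mul, abs_of_pos hac, mul_le_iff_le_one_left hac, abs_le] at hp
  -- The chord of `s ↦ cosh √s` over `[(a - c)², (a + c)²]` is affine in `p`.
  have hchord := convexOn_cosh_sqrt.2 (mem_Ici.2 (sq_nonneg (a + c)))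
    (mem_Ici.2 (sq_nonneg (a - c))) (by linarith : 0 ≤ (1 + u) / 2)
    (by linarith : 0 ≤ (1 - u) / 2) (by ring)
  simp only [smul_eq_mul] at hchord
  rw [Real.sqrt_sq_eq_abs, Real.sqrt_sq_eq_abs, Real.cosh_abs, Real.cosh_abs, Real.cosh_add,
    Real.cosh_sub] at hchord
  calc Real.cosh √(a ^ 2 + c ^ 2 + 2 * (u * (a * c)))
      = Real.cosh √((1 + u) / 2 * (a + c) ^ 2 + (1 - u) / 2 * (a - c) ^ 2) := by ring_nf
    _ ≤ _ := hchord
    _ = Real.cosh a * Real.cosh c + u * (Real.sinh a * Real.sinh c) := by ring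
    _ = _ := by rw [mul_left_comm _ u, div_mul_cancel₀ _ hac.ne']

theorem exists_cosh_norm_add_le (v : H) {c : ℝ} (hc : 0 ≤ c) :
    ∃ q : ℝ, ∀ d : H, ‖d‖ ≤ c →
      Real.cosh ‖v + d‖ ≤ Real.cosh ‖v‖ * Real.cosh c + q * ⟪v, d⟫_ℝ := by
  obtain ⟨q, hq⟩ := exists_cosh_sqrt_le (norm_nonneg v) hc
  refine ⟨q, fun d hd => le_trans ?_ (hq ⟪v, d⟫_ℝ ((abs_real_inner_le_norm v d).trans (by gcongr)))⟩
  rw [Real.cosh_le_cosh, abs_norm, abs_of_nonneg (Real.sqrt_nonneg _)]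
  refine Real.le_sqrt_of_sq_le ?_
  rw [norm_add_sq_real]
  have hsq : ‖d‖ ^ 2 ≤ c ^ 2 := by gcongr
  linarith

theorem lintegral_cosh_norm_add_le [IsProbabilityMeasure μ] {ξ : Ω → H} {c : ℝ} (v : H)
    (hξ : ∀ᵐ ω ∂μ, ‖ξ ω‖ ≤ c) (hint : Integrable (fun ω => ⟪v, ξ ω⟫_ℝ) μ)
    (hmean : ∫ ω, ⟪v, ξ ω⟫_ℝ ∂μ = 0) :
    ∫⁻ ω, ENNReal.ofReal (Real.cosh ‖v + ξ ω‖) ∂μ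
      ≤ ENNReal.ofReal (Real.cosh ‖v‖ * Real.exp (c ^ 2 / 2)) := by
  obtain ⟨ω₀, hω₀⟩ := hξ.exists
  obtain ⟨q, hq⟩ := exists_cosh_norm_add_le v ((norm_nonneg _).trans hω₀)
  have hbound : ∀ᵐ ω ∂μ, Real.cosh ‖v + ξ ω‖ ≤ Real.cosh ‖v‖ * Real.cosh c + q * ⟪v, ξ ω⟫_ℝ :=
    hξ.mono fun ω hω => hq _ hω
  calc ∫⁻ ω, ENNReal.ofReal (Real.cosh ‖v + ξ ω‖) ∂μ
      ≤ ∫⁻ ω, ENNReal.ofReal (Real.cosh ‖v‖ * Real.cosh c + q * ⟪v, ξ ω⟫_ℝ) ∂μ :=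
        lintegral_mono_ae (hbound.mono fun ω hω => ENNReal.ofReal_le_ofReal hω)
    _ = ENNReal.ofReal (∫ ω, Real.cosh ‖v‖ * Real.cosh c + q * ⟪v, ξ ω⟫_ℝ ∂μ) :=
        (ofReal_integral_eq_lintegral_ofReal ((integrable_const _).add (hint.const_mul q))
          (hbound.mono fun ω hω => (Real.cosh_pos _).le.trans hω)).symm
    _ = ENNReal.ofReal (Real.cosh ‖v‖ * Real.cosh c) := by
        rw [integral_add (integrable_const _) (hint.const_mul q), integral_const_mul q, hmean]
        simp
    _ ≤ ENNReal.ofReal (Real.cosh ‖v‖ * Real.exp (c ^ 2 / 2)) := by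
        gcongr
        exact Real.cosh_le_exp_half_sq c

theorem measureReal_ge_le_of_lintegral_cosh_le [IsFiniteMeasure μ] {D : Ω → ℝ}
    (hD : AEMeasurable D μ) {a r V : ℝ} (ha : 0 ≤ a) (har : a ≤ r) (hV : 0 < V)
    (hcosh : ∀ θ, 0 ≤ θ → ∫⁻ ω, ENNReal.ofReal (Real.cosh (θ * D ω)) ∂μ
      ≤ ENNReal.ofReal (Real.cosh (θ * a) * Real.exp (θ ^ 2 * V / 2))) :
    μ.real {ω | r ≤ D ω} ≤ 2 * Real.exp (-((r - a) ^ 2 / (2 * V))) := by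
  have hr : 0 ≤ r := ha.trans har
  set θ := (r - a) / V with hθ_def
  have hθ : 0 ≤ θ := div_nonneg (sub_nonneg.2 har) hV.le
  have hsubset : {ω | r ≤ D ω}
      ⊆ {ω | ENNReal.ofReal (Real.cosh (θ * r)) ≤ ENNReal.ofReal (Real.cosh (θ * D ω))} := by
    intro ω (hω : r ≤ D ω)
    refine ENNReal.ofReal_le_ofReal (Real.cosh_le_cosh.2 ?_)
    rw [abs_of_nonneg (by positivity), abs_of_nonneg (mul_nonneg hθ (hr.trans hω))]
    gcongr
  have hmarkov : Real.cosh (θ * r) * μ.real {ω | r ≤ D ω}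
      ≤ Real.cosh (θ * a) * Real.exp (θ ^ 2 * V / 2) := by
    rw [← ENNReal.ofReal_le_ofReal_iff (by positivity), ENNReal.ofReal_mul (by positivity),
      ofReal_measureReal]
    calc _ ≤ ENNReal.ofReal (Real.cosh (θ * r)) * μ {ω | ENNReal.ofReal (Real.cosh (θ * r))
            ≤ ENNReal.ofReal (Real.cosh (θ * D ω))} := by gcongr
      _ ≤ ∫⁻ ω, ENNReal.ofReal (Real.cosh (θ * D ω)) ∂μ :=
          mul_meas_ge_le_lintegral₀
            (Real.measurable_cosh.comp_aemeasurable (hD.const_mul θ)).ennreal_ofReal _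
      _ ≤ _ := hcosh θ hθ
  have hlower : Real.exp (θ * r) / 2 ≤ Real.cosh (θ * r) := by
    rw [Real.cosh_eq]
    linarith [Real.exp_pos (-(θ * r))]
  have hupper : Real.cosh (θ * a) ≤ Real.exp (θ * a) := by
    rw [Real.cosh_eq]
    linarith [Real.exp_le_exp.2 (neg_le_self (mul_nonneg hθ ha))]
  have hexponent : θ * a + θ ^ 2 * V / 2 = θ * r - (r - a) ^ 2 / (2 * V) := by
    rw [hθ_def]; field_simp; ring
  refine le_of_mul_le_mul_left ?_ (half_pos (Real.exp_pos (θ * r)))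
  calc Real.exp (θ * r) / 2 * μ.real {ω | r ≤ D ω}
      ≤ Real.cosh (θ * r) * μ.real {ω | r ≤ D ω} := by gcongr
    _ ≤ Real.cosh (θ * a) * Real.exp (θ ^ 2 * V / 2) := hmarkov
    _ ≤ Real.exp (θ * a) * Real.exp (θ ^ 2 * V / 2) := by gcongr
    _ = Real.exp (θ * r) / 2 * (2 * Real.exp (-((r - a) ^ 2 / (2 * V)))) := by
        rw [← Real.exp_add, hexponent, sub_eq_add_neg, Real.exp_add]
        ring

end Concentration

section Loss

variable {φ : ℝ → ℝ} {M : ℝ}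

theorem lossDeriv_eq (hφ : Differentiable ℝ φ) (ζ : ℝ) (y : ℤˣ) :
    lossDeriv φ ζ y = lab y * deriv φ (lab y * ζ) := by
  have hderiv : HasDerivAt (fun u => loss φ u y) (deriv φ (lab y * ζ) * (lab y * 1)) ζ :=
    (hφ (lab y * ζ)).hasDerivAt.comp ζ ((hasDerivAt_id ζ).const_mul (lab y))
  rw [lossDeriv, hderiv.deriv, mul_one, mul_comm]

theorem add_deriv_mul_sub_le (hφ : Differentiable ℝ φ) (hconv : ConvexOn ℝ univ φ) (a b : ℝ) :
    φ a + deriv φ a * (b - a) ≤ φ b := by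
  rcases lt_trichotomy a b with hab | rfl | hba
  · have hslope := hconv.deriv_le_slope (mem_univ a) (mem_univ b) hab (hφ a)
    rw [slope_def_field, le_div_iff₀ (sub_pos.2 hab)] at hslope
    linarith
  · simp
  · have hslope := hconv.slope_le_deriv (mem_univ b) (mem_univ a) hba (hφ a)
    rw [slope_def_field, div_le_iff₀ (sub_pos.2 hba)] at hslope
    linarith

theorem loss_add_lossDeriv_mul_sub_le (hφ : Differentiable ℝ φ) (hconv : ConvexOn ℝ univ φ)
    (a b : ℝ) (y : ℤˣ) : loss φ a y + lossDeriv φ a y * (b - a) ≤ loss φ b y := by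
  have htangent := add_deriv_mul_sub_le hφ hconv (lab y * a) (lab y * b)
  rw [lossDeriv_eq hφ, loss, loss]
  linarith

theorem loss_le (hφ : Differentiable ℝ φ) (hconv : ConvexOn ℝ univ φ)
    (hM : ∀ ζ y, |lossDeriv φ ζ y| ≤ M) (a : ℝ) (y : ℤˣ) : loss φ a y ≤ φ 0 + M * |a| := by
  have htangent := loss_add_lossDeriv_mul_sub_le hφ hconv a 0 y
  have hslope : lossDeriv φ a y * a ≤ M * |a| :=
    (le_abs_self _).trans (by rw [abs_mul]; gcongr; exact hM a y)
  have hzero : loss φ 0 y = φ 0 := by simp [loss]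
  linarith

theorem measurable_loss (hφ : Measurable φ) : Measurable fun p : ℝ × ℤˣ => loss φ p.1 p.2 :=
  hφ.comp (((measurable_of_countable lab).comp measurable_snd).mul measurable_fst)

theorem measurable_lossDeriv (hφ : Differentiable ℝ φ) :
    Measurable fun p : ℝ × ℤˣ => lossDeriv φ p.1 p.2 := by
  have hlab : Measurable fun p : ℝ × ℤˣ => lab p.2 :=
    (measurable_of_countable lab).comp measurable_snd
  simp_rw [lossDeriv_eq hφ]
  exact hlab.mul ((measurable_deriv φ).comp (hlab.mul measurable_fst))

end Loss

section Kernel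

variable {X H : Type*} [NormedAddCommGroup H] [InnerProductSpace ℝ H] [CompleteSpace H]
  [RKHS ℝ H X ℝ] {R : ℝ}

theorem inner_feature (g : H) (x : X) : ⟪g, feature H x⟫_ℝ = g x := by
  simp [feature]

theorem feature_apply (x x' : X) : feature H x x' = ker H x' x := by
  rw [feature, RKHS.kerFun_apply, ker]

theorem norm_feature_le (hR : 0 ≤ R) (hker : ∀ x : X, ker H x x ≤ R ^ 2) (x : X) :
    ‖feature H x‖ ≤ R := by
  refine le_of_sq_le_sq ?_ hR
  rw [← real_inner_self_eq_norm_sq, inner_feature, feature_apply]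
  exact hker x

theorem abs_apply_le (hR : 0 ≤ R) (hker : ∀ x : X, ker H x x ≤ R ^ 2) (g : H) (x : X) :
    |g x| ≤ R * ‖g‖ := by
  rw [← inner_feature, mul_comm]
  exact (abs_real_inner_le_norm _ _).trans (by gcongr; exact norm_feature_le hR hker x)

theorem measurable_coe [MeasurableSpace X] (hker : ∀ x, Measurable fun x' : X => ker H x' x)
    (g : H) : Measurable (g : X → ℝ) := by
  have hspan : ∀ u ∈ Submodule.span ℝ {RKHS.kerFun H x v | (x : X) (v : ℝ)},
      Measurable (u : X → ℝ) := fun u hu => by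
    induction hu using Submodule.span_induction with
    | mem u hu =>
      obtain ⟨x, v, rfl⟩ := hu
      rw [show RKHS.kerFun H x v = v • feature H x by
        rw [feature, ← map_smul, smul_eq_mul, mul_one], RKHS.coe_smul]
      exact ((funext (feature_apply x) : (feature H x : X → ℝ) = _) ▸ hker x).const_smul v
    | zero => exact RKHS.coe_zero (𝕜 := ℝ) (H := H) ▸ measurable_zero
    | add u w _ _ hu hw => exact RKHS.coe_add u w ▸ hu.add hw
    | smul c u _ hu => exact RKHS.coe_smul u c ▸ hu.const_smul c
  have hg : g ∈ closure (Submodule.span ℝ {RKHS.kerFun H x v | (x : X) (v : ℝ)} : Set H) := by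
    rw [← Submodule.topologicalClosure_coe, RKHS.kerFun_dense]
    trivial
  obtain ⟨u, hu, hlim⟩ := mem_closure_iff_seq_limit.1 hg
  exact measurable_of_tendsto_metrizable (fun n => hspan _ (hu n))
    (tendsto_pi_nhds.2 fun x => ((RKHS.continuous_eval x).tendsto g).comp hlim)

theorem inner_stochGrad (φ : ℝ → ℝ) (g h : H) (z : X × ℤˣ) :
    ⟪h, stochGrad φ g z⟫_ℝ = lossDeriv φ (g z.1) z.2 * h z.1 := by
  rw [stochGrad, inner_smul_right, inner_feature]

end Kernel

section Risk

variable {X : Type*} [MeasurableSpace X] {H : Type*} [NormedAddCommGroup H]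
  [InnerProductSpace ℝ H] [CompleteSpace H] [RKHS ℝ H X ℝ]

/-- The standing assumptions on the loss and the kernel: `φ` is convex and differentiable, the loss
is `M`-Lipschitz, the risk is `L`-smooth on `H`, and the measurable kernel is bounded by `R²`.
Smoothness is imposed in the one-sided form. -/
structure SmoothProblem (H : Type*) [NormedAddCommGroup H] [InnerProductSpace ℝ H]
    [CompleteSpace H] [RKHS ℝ H X ℝ] (φ : ℝ → ℝ) (ρ : Measure (X × ℤˣ)) (M L R : ℝ) : Prop where
  measurable_ker : Measurable fun p : X × X => ker H p.1 p.2
  nonneg : ∀ v, 0 ≤ φ v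
  differentiable : Differentiable ℝ φ
  convex : ConvexOn ℝ univ φ
  M_pos : 0 < M
  abs_lossDeriv_le : ∀ (ζ : ℝ) (y : ℤˣ), |lossDeriv φ ζ y| ≤ M
  L_pos : 0 < L
  smooth : HasQuadraticUpperBound L (riskH φ ρ : H → ℝ) (gradient (riskH φ ρ))
  R_pos : 0 < R
  ker_le : ∀ x : X, ker H x x ≤ R ^ 2

namespace SmoothProblem

variable {φ : ℝ → ℝ} {ρ : Measure (X × ℤˣ)} {M L R : ℝ}

theorem measurable_coe (hP : SmoothProblem H φ ρ M L R) (g : H) : Measurable (g : X → ℝ) :=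
  KernelSGD.measurable_coe (fun _ => hP.measurable_ker.of_uncurry_right) g

theorem measurable_prodMk_apply (hP : SmoothProblem H φ ρ M L R) (g : H) :
    Measurable fun z : X × ℤˣ => (g z.1, z.2) :=
  ((hP.measurable_coe g).comp measurable_fst).prodMk measurable_snd

theorem norm_stochGrad_le (hP : SmoothProblem H φ ρ M L R) (g : H) (z : X × ℤˣ) :
    ‖stochGrad φ g z‖ ≤ M * R := by
  rw [stochGrad, norm_smul]
  exact mul_le_mul (hP.abs_lossDeriv_le _ _) (norm_feature_le hP.R_pos.le hP.ker_le _)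
    (norm_nonneg _) hP.M_pos.le

theorem abs_lossDeriv_mul_le (hP : SmoothProblem H φ ρ M L R) (g h : H) (z : X × ℤˣ) :
    |lossDeriv φ (g z.1) z.2 * h z.1| ≤ M * R * ‖h‖ := by
  rw [← inner_stochGrad, mul_comm]
  exact (abs_real_inner_le_norm _ _).trans (by gcongr; exact hP.norm_stochGrad_le g z)

variable [IsProbabilityMeasure ρ]

theorem finiteRisk (hP : SmoothProblem H φ ρ M L R) (g : H) : FiniteRisk φ ρ g := by
  have hM := hP.M_pos
  refine Integrable.of_bound (C := φ 0 + M * (R * ‖g‖)) ((measurable_loss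
    hP.differentiable.continuous.measurable).comp
      (hP.measurable_prodMk_apply g)).aestronglyMeasurable (ae_of_all _ fun z => ?_)
  rw [Real.norm_eq_abs, loss, abs_of_nonneg (hP.nonneg _)]
  refine (loss_le hP.differentiable hP.convex hP.abs_lossDeriv_le _ _).trans ?_
  gcongr
  exact abs_apply_le hP.R_pos.le hP.ker_le g z.1

theorem integrable_lossDeriv_mul (hP : SmoothProblem H φ ρ M L R) (g h : H) :
    Integrable (fun z : X × ℤˣ => lossDeriv φ (g z.1) z.2 * h z.1) ρ :=
  .of_bound (((measurable_lossDeriv hP.differentiable).comp (hP.measurable_prodMk_apply g)).mul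
    ((hP.measurable_coe h).comp measurable_fst)).aestronglyMeasurable (M * R * ‖h‖)
      (ae_of_all _ fun z => hP.abs_lossDeriv_mul_le g h z)

theorem riskH_add_integral_le (hP : SmoothProblem H φ ρ M L R) (g h : H) :
    riskH φ ρ g + ∫ z, lossDeriv φ (g z.1) z.2 * h z.1 ∂ρ ≤ riskH φ ρ (g + h) := by
  rw [riskH, riskH, risk, risk, ← integral_add (hP.finiteRisk g) (hP.integrable_lossDeriv_mul g h)]
  refine integral_mono ((hP.finiteRisk g).add (hP.integrable_lossDeriv_mul g h))
    (hP.finiteRisk _) fun z => ?_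
  simpa using
    loss_add_lossDeriv_mul_sub_le hP.differentiable hP.convex (g z.1) ((g + h : H) z.1) z.2

theorem inner_gradient (hP : SmoothProblem H φ ρ M L R) (g h : H) :
    ⟪gradient (riskH φ ρ) g, h⟫_ℝ = ∫ z, lossDeriv φ (g z.1) z.2 * h z.1 ∂ρ := by
  refine hP.smooth.inner_eq (l := fun h => ∫ z, lossDeriv φ (g z.1) z.2 * h z.1 ∂ρ)
    (fun t k => ?_) (hP.riskH_add_integral_le g) h
  simp only [RKHS.coe_smul, Pi.smul_apply, smul_eq_mul, mul_left_comm _ t, integral_const_mul]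

theorem isSubgradientField (hP : SmoothProblem H φ ρ M L R) :
    IsSubgradientField (riskH φ ρ : H → ℝ) (gradient (riskH φ ρ)) := fun g h => by
  rw [hP.inner_gradient]
  exact (hP.riskH_add_integral_le g (h - g)).trans_eq (by rw [add_sub_cancel])

theorem norm_gradient_le (hP : SmoothProblem H φ ρ M L R) (g : H) :
    ‖gradient (riskH φ ρ) g‖ ≤ M * R := by
  set G := gradient (riskH φ ρ) g with hG
  have hM := hP.M_pos
  have hR := hP.R_pos
  have hsq : ‖G‖ * ‖G‖ ≤ M * R * ‖G‖ := by
    rw [← real_inner_self_eq_norm_mul_norm, hG, hP.inner_gradient, ← hG]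
    have hbound := norm_integral_le_of_norm_le_const (μ := ρ)
      (f := fun z => lossDeriv φ (g z.1) z.2 * G z.1) (ae_of_all _ (hP.abs_lossDeriv_mul_le g G))
    rw [probReal_univ, mul_one] at hbound
    exact (le_abs_self _).trans hbound
  rcases (norm_nonneg G).eq_or_lt with hG0 | hG0
  · rw [← hG0]; positivity
  · exact le_of_mul_le_mul_right hsq hG0

theorem norm_stochGrad_sub_gradient_le (hP : SmoothProblem H φ ρ M L R) (g : H) (z : X × ℤˣ) :
    ‖stochGrad φ g z - gradient (riskH φ ρ) g‖ ≤ 2 * M * R :=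
  (norm_sub_le_of_le (hP.norm_stochGrad_le g z) (hP.norm_gradient_le g)).trans_eq (by ring)

theorem integrable_inner_noise (hP : SmoothProblem H φ ρ M L R) (g h : H) :
    Integrable (fun z => ⟪h, stochGrad φ g z - gradient (riskH φ ρ) g⟫_ℝ) ρ := by
  simp_rw [inner_sub_right, inner_stochGrad]
  exact (hP.integrable_lossDeriv_mul g h).sub (integrable_const _)

theorem integral_inner_noise (hP : SmoothProblem H φ ρ M L R) (g h : H) :
    ∫ z, ⟪h, stochGrad φ g z - gradient (riskH φ ρ) g⟫_ℝ ∂ρ = 0 := by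
  simp_rw [inner_sub_right, inner_stochGrad]
  rw [integral_sub (hP.integrable_lossDeriv_mul g h) (integrable_const _), ← hP.inner_gradient,
    real_inner_comm, integral_const, probReal_univ, one_smul, sub_self]

theorem lintegral_cosh_step_le (hP : SmoothProblem H φ ρ M L R) {lam η θ : ℝ} (hη : 0 ≤ η)
    (hηL : η * (L + lam) ≤ 1) (hθ : 0 ≤ θ) {gl : H}
    (hgl : gradient (riskH φ ρ) gl + lam • gl = 0) (g : H) :
    ∫⁻ z, ENNReal.ofReal (Real.cosh (θ * ‖g - η • regStochGrad φ lam g z - gl‖)) ∂ρ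
      ≤ ENNReal.ofReal (Real.cosh (θ * (1 - η * lam) * ‖g - gl‖)
          * Real.exp (θ ^ 2 * (η * (2 * M * R)) ^ 2 / 2)) := by
  set G := gradient (riskH φ ρ : H → ℝ)
  set v : H := (g - η • (G g + lam • g)) - (gl - η • (G gl + lam • gl)) with hv
  have hdecomp : ∀ z, θ * ‖g - η • regStochGrad φ lam g z - gl‖
      = ‖θ • v + (-(θ * η)) • (stochGrad φ g z - G g)‖ := fun z => by
    rw [← abs_of_nonneg hθ, ← Real.norm_eq_abs, ← norm_smul, Real.norm_eq_abs, abs_of_nonneg hθ,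
      hv, hgl, regStochGrad]
    congr 1
    module
  have hnoise : ∀ z, ‖(-(θ * η)) • (stochGrad φ g z - G g)‖ ≤ θ * η * (2 * M * R) := fun z => by
    rw [norm_smul, norm_neg, Real.norm_eq_abs, abs_of_nonneg (by positivity)]
    gcongr
    exact hP.norm_stochGrad_sub_gradient_le g z
  have hcontract : ‖θ • v‖ ≤ θ * (1 - η * lam) * ‖g - gl‖ := by
    rw [norm_smul, Real.norm_eq_abs, abs_of_nonneg hθ, mul_assoc]
    gcongr
    exact hP.isSubgradientField.norm_gradient_step_sub_le hP.smooth hP.L_pos hη hηL g gl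
  simp_rw [hdecomp]
  calc ∫⁻ z, ENNReal.ofReal (Real.cosh ‖θ • v + (-(θ * η)) • (stochGrad φ g z - G g)‖) ∂ρ
      ≤ ENNReal.ofReal (Real.cosh ‖θ • v‖ * Real.exp ((θ * η * (2 * M * R)) ^ 2 / 2)) := by
        refine lintegral_cosh_norm_add_le _ (ae_of_all _ hnoise) ?_ ?_ <;>
          simp_rw [inner_smul_right]
        · exact (hP.integrable_inner_noise g _).const_mul _
        · rw [integral_const_mul, hP.integral_inner_noise, mul_zero]
    _ ≤ _ := by
        rw [mul_assoc θ η, mul_pow θ]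
        gcongr
        rw [Real.cosh_le_cosh, abs_norm]
        exact hcontract.trans (le_abs_self _)

end SmoothProblem

end Risk

section Measurability

variable {X H A B : Type*} [MeasurableSpace X] [NormedAddCommGroup H] [InnerProductSpace ℝ H]
  [RKHS ℝ H X ℝ] [MeasurableSpace A] [MeasurableSpace B]

theorem measurable_ker_comp [CompleteSpace H] (hker : Measurable fun p : X × X => ker H p.1 p.2)
    {f g : A → X} (hf : Measurable f) (hg : Measurable g) :
    Measurable fun a => ker H (f a) (g a) := by
  simpa only [Function.comp_def] using hker.comp (hf.prodMk hg)

/-- A random function `G` in `H` with jointly measurable evaluations, measurable norm and measurable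
inner products. It replaces strong measurability because `H` need not be separable. -/
structure WeaklyMeasurable (G : A → H) : Prop where
  eval : Measurable fun p : A × X => G p.1 p.2
  norm : Measurable fun a => ‖G a‖
  inner : ∀ h, Measurable fun a => ⟪h, G a⟫_ℝ

namespace WeaklyMeasurable

variable {G : A → H}

theorem comp (hG : WeaklyMeasurable G) {f : B → A} (hf : Measurable f) :
    WeaklyMeasurable fun b => G (f b) :=
  ⟨hG.eval.comp ((hf.comp measurable_fst).prodMk measurable_snd), hG.norm.comp hf,
    fun h => (hG.inner h).comp hf⟩

theorem norm_sub (hG : WeaklyMeasurable G) (h : H) : Measurable fun a => ‖G a - h‖ := by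
  have hnorm : ∀ a, ‖G a - h‖ = √(‖h‖ ^ 2 - 2 * ⟪h, G a⟫_ℝ + ‖G a‖ ^ 2) := fun a => by
    rw [← norm_sub_sq_real, Real.sqrt_sq (norm_nonneg _), norm_sub_rev]
  simp_rw [hnorm]
  exact ((measurable_const.sub ((hG.inner h).const_mul 2)).add (hG.norm.pow_const 2)).sqrt

variable [CompleteSpace H]

theorem const (hker : ∀ x, Measurable fun x' : X => ker H x' x) (g : H) :
    WeaklyMeasurable fun _ : A => g :=
  ⟨(measurable_coe hker g).comp measurable_snd, measurable_const, fun _ => measurable_const⟩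

theorem smul_add_smul_feature (hker : Measurable fun p : X × X => ker H p.1 p.2)
    (hG : WeaklyMeasurable G) (α : ℝ) {c : A → ℝ} (hc : Measurable c) {x : A → X}
    (hx : Measurable x) : WeaklyMeasurable fun a => α • G a + c a • feature H (x a) := by
  have heval : ∀ p : A × X, (α • G p.1 + c p.1 • feature H (x p.1) : H) p.2
      = α * G p.1 p.2 + c p.1 * ker H p.2 (x p.1) := fun p => by simp [feature_apply]
  have hnorm : ∀ a, ‖α • G a + c a • feature H (x a)‖
      = √(α ^ 2 * ‖G a‖ ^ 2 + 2 * (α * (c a * G a (x a))) + c a ^ 2 * ker H (x a) (x a)) :=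
    fun a => by
      rw [← Real.sqrt_sq (norm_nonneg (α • G a + _)), norm_add_sq_real, norm_smul, norm_smul,
        real_inner_smul_left, real_inner_smul_right, inner_feature, mul_pow, mul_pow,
        ← real_inner_self_eq_norm_sq (feature H (x a)), inner_feature, feature_apply,
        Real.norm_eq_abs, Real.norm_eq_abs, sq_abs, sq_abs]
  refine ⟨?_, ?_, fun h => ?_⟩
  · simp_rw [heval]
    exact (hG.eval.const_mul α).add ((hc.comp measurable_fst).mul
      (measurable_ker_comp hker measurable_snd (hx.comp measurable_fst)))
  · have hGx : Measurable fun a => G a (x a) := hG.eval.comp (measurable_id.prodMk hx)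
    simp_rw [hnorm]
    exact ((((hG.norm.pow_const 2).const_mul _).add (((hc.mul hGx).const_mul α).const_mul 2)).add
      ((hc.pow_const 2).mul (measurable_ker_comp hker hx hx))).sqrt
  · simp_rw [inner_add_right, real_inner_smul_right, inner_feature]
    exact ((hG.inner h).const_mul α).add
      (hc.mul ((measurable_coe (fun _ => hker.of_uncurry_right) h).comp hx))

theorem sub_smul_regStochGrad (hker : Measurable fun p : X × X => ker H p.1 p.2) {φ : ℝ → ℝ}
    (hφ : Differentiable ℝ φ) (hG : WeaklyMeasurable G) (lam η : ℝ) {z : A → X × ℤˣ}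
    (hz : Measurable z) : WeaklyMeasurable fun a => G a - η • regStochGrad φ lam (G a) (z a) := by
  have hslope : Measurable fun a => lossDeriv φ (G a (z a).1) (z a).2 :=
    (measurable_lossDeriv hφ).comp ((hG.eval.comp (measurable_id.prodMk hz.fst)).prodMk hz.snd)
  have hstep : ∀ a, G a - η • regStochGrad φ lam (G a) (z a) = (1 - η * lam) • G a
      + (-η * lossDeriv φ (G a (z a).1) (z a).2) • feature H (z a).1 := fun a => by
    rw [regStochGrad, stochGrad]; module
  simp_rw [hstep]
  exact hG.smul_add_smul_feature hker _ (hslope.const_mul (-η)) hz.fst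

end WeaklyMeasurable

variable [CompleteSpace H]

theorem weaklyMeasurable_sgd (hker : Measurable fun p : X × X => ker H p.1 p.2) {φ : ℝ → ℝ}
    (hφ : Differentiable ℝ φ) (lam γ : ℝ) (g₁ : H) (n : ℕ) :
    WeaklyMeasurable fun u : ℕ → X × ℤˣ => sgd φ lam γ g₁ u n := by
  induction n with
  | zero => exact .const (fun _ => hker.of_uncurry_right) g₁
  | succ n ih => exact ih.sub_smul_regStochGrad hker hφ lam _ (measurable_pi_apply (n + 1))

end Measurability

theorem sgd_congr {X H : Type*} [NormedAddCommGroup H] [InnerProductSpace ℝ H] [CompleteSpace H]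
    [RKHS ℝ H X ℝ] (φ : ℝ → ℝ) (lam γ : ℝ) (g₁ : H) {u v : ℕ → X × ℤˣ} {n : ℕ}
    (h : ∀ i ≤ n, u i = v i) : sgd φ lam γ g₁ u n = sgd φ lam γ g₁ v n := by
  induction n with
  | zero => rfl
  | succ n ih => rw [sgd, sgd, ih fun i hi => h i (hi.trans n.le_succ), h (n + 1) le_rfl]

section Resampling

variable {ι : Type*} [DecidableEq ι] {S : ι → Type*} [∀ i, MeasurableSpace (S i)]

theorem map_update_prod_infinitePi (μ : ∀ i, Measure (S i)) [∀ i, IsProbabilityMeasure (μ i)]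
    (i : ι) : ((Measure.infinitePi μ).prod (μ i)).map (fun p => Function.update p.1 i p.2)
      = Measure.infinitePi μ := by
  refine Measure.eq_infinitePi μ fun s t ht => ?_
  have hpreimage : (fun p : (∀ i, S i) × S i => Function.update p.1 i p.2) ⁻¹' (Set.pi s t)
      = (Set.pi (s.erase i : Finset ι) t) ×ˢ {b | i ∈ s → b ∈ t i} := by
    ext p
    rw [mem_preimage, Set.update_mem_pi_iff, Finset.coe_erase]
    rfl
  rw [Measure.map_apply measurable_update' (.pi s.countable_toSet fun j _ => ht j), hpreimage,
    Measure.prod_prod, Measure.infinitePi_pi _ fun j _ => ht j]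
  by_cases hi : i ∈ s
  · simp [hi, Finset.prod_erase_mul]
  · simp [hi]

theorem lintegral_infinitePi_update (μ : ∀ i, Measure (S i)) [∀ i, IsProbabilityMeasure (μ i)]
    (i : ι) {f : (∀ i, S i) → ENNReal} (hf : Measurable f) :
    ∫⁻ u, f u ∂Measure.infinitePi μ
      = ∫⁻ u, ∫⁻ x, f (Function.update u i x) ∂μ i ∂Measure.infinitePi μ := by
  conv_lhs => rw [← map_update_prod_infinitePi μ i]
  rw [lintegral_map hf measurable_update']
  exact lintegral_prod _ (hf.comp measurable_update').aemeasurable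

end Resampling

section StepSize

variable {L lam γ : ℝ}

theorem stepSize_nonneg (hlam : 0 ≤ lam) (hγ : 0 ≤ γ) (n : ℕ) : 0 ≤ stepSize lam γ n := by
  rw [stepSize]; positivity

theorem stepSize_succ_le (hlam : 0 < lam) (hγ : 0 ≤ γ) (n : ℕ) :
    stepSize lam γ (n + 1) ≤ stepSize lam γ 1 := by
  rw [stepSize, stepSize]
  gcongr
  exact n.succ_pos

theorem one_lt_of_stepSize_one_le (hL : 0 < L) (hlam : 0 < lam) (hγ : 0 ≤ γ)
    (hη : stepSize lam γ 1 ≤ 1 / (L + lam)) : 1 < γ := by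
  rw [stepSize, div_le_div_iff₀ (by positivity) (by positivity), Nat.cast_one] at hη
  have hmul : lam * 1 < lam * γ := by linarith
  exact lt_of_mul_lt_mul_left hmul hlam.le

theorem one_sub_stepSize_succ_mul (hlam : 0 < lam) (hγ : 0 ≤ γ) (n : ℕ) :
    1 - stepSize lam γ (n + 1) * lam = (γ + n - 1) / (γ + n + 1) := by
  rw [stepSize]
  push_cast
  field_simp
  ring

theorem stepSize_succ_mul (hlam : 0 < lam) (hγ : 0 ≤ γ) (n : ℕ) (c : ℝ) :
    stepSize lam γ (n + 1) * c = 2 * c / lam / (γ + n + 1) := by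
  rw [stepSize]
  push_cast
  field_simp
  ring

theorem contraction_mul_bias_le {N : ℝ} (hN : 1 ≤ N) (hγ : 0 ≤ γ) :
    (N - 1) / (N + 1) * (γ / N) ≤ γ / (N + 1) := by
  have hN0 : 0 < N := zero_lt_one.trans_le hN
  calc (N - 1) / (N + 1) * (γ / N) = (N - 1) / N * (γ / (N + 1)) := by
        rw [div_mul_div_comm, div_mul_div_comm, mul_comm N]
    _ ≤ 1 * (γ / (N + 1)) := by
        gcongr
        exact (div_le_one hN0).2 (by linarith)
    _ = _ := one_mul _

theorem contraction_sq_mul_variance_add_le {N : ℝ} (hN : 1 ≤ N) (K : ℝ) :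
    ((N - 1) / (N + 1)) ^ 2 * (K ^ 2 / N) + (K / (N + 1)) ^ 2 ≤ K ^ 2 / (N + 1) := by
  have hN0 : 0 < N := zero_lt_one.trans_le hN
  have hgap : K ^ 2 / (N + 1) - (((N - 1) / (N + 1)) ^ 2 * (K ^ 2 / N) + (K / (N + 1)) ^ 2)
      = K ^ 2 * (2 * N - 1) / (N * (N + 1) ^ 2) := by
    have := hN0.ne'
    field_simp
    ring
  have hnonneg : 0 ≤ K ^ 2 * (2 * N - 1) / (N * (N + 1) ^ 2) :=
    div_nonneg (mul_nonneg (sq_nonneg K) (by linarith)) (by positivity)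
  linarith

end StepSize

namespace SmoothProblem

variable {X : Type*} [MeasurableSpace X] {H : Type*} [NormedAddCommGroup H]
  [InnerProductSpace ℝ H] [CompleteSpace H] [RKHS ℝ H X ℝ]
  {φ : ℝ → ℝ} {ρ : Measure (X × ℤˣ)} {M L R lam γ : ℝ} {gl : H}

theorem measurable_norm_sgd_sub (hP : SmoothProblem H φ ρ M L R) (lam γ : ℝ) (g₁ gl : H) (n : ℕ) :
    Measurable fun u : ℕ → X × ℤˣ => ‖sgd φ lam γ g₁ u n - gl‖ :=
  (weaklyMeasurable_sgd hP.measurable_ker hP.differentiable lam γ g₁ n).norm_sub gl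

variable [IsProbabilityMeasure ρ]

theorem lintegral_cosh_sgd_succ_le (hP : SmoothProblem H φ ρ M L R) (hlam : 0 < lam) (hγ : 0 ≤ γ)
    (hη : stepSize lam γ 1 ≤ 1 / (L + lam)) (hgl : gradient (riskH φ ρ) gl + lam • gl = 0) (g₁ : H)
    (n : ℕ) {θ : ℝ} (hθ : 0 ≤ θ) :
    ∫⁻ u, ENNReal.ofReal (Real.cosh (θ * ‖sgd φ lam γ g₁ u (n + 1) - gl‖))
        ∂Measure.infinitePi (fun _ : ℕ => ρ)
      ≤ (∫⁻ u, ENNReal.ofReal (Real.cosh (θ * (1 - stepSize lam γ (n + 1) * lam)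
          * ‖sgd φ lam γ g₁ u n - gl‖)) ∂Measure.infinitePi (fun _ : ℕ => ρ))
        * ENNReal.ofReal (Real.exp (θ ^ 2 * (stepSize lam γ (n + 1) * (2 * M * R)) ^ 2 / 2)) := by
  set η := stepSize lam γ (n + 1)
  have hη0 : 0 ≤ η := stepSize_nonneg hlam.le hγ _
  have hL := hP.L_pos
  have hηL : η * (L + lam) ≤ 1 :=
    (le_div_iff₀ (by positivity)).1 ((stepSize_succ_le hlam hγ n).trans hη)
  have hstep : ∀ (u : ℕ → X × ℤˣ) (z : X × ℤˣ),
      sgd φ lam γ g₁ (Function.update u (n + 1) z) (n + 1)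
        = sgd φ lam γ g₁ u n - η • regStochGrad φ lam (sgd φ lam γ g₁ u n) z := fun u z => by
    rw [sgd, Function.update_self, sgd_congr φ lam γ g₁ fun i hi =>
      Function.update_of_ne (Nat.lt_succ_of_le hi).ne z u]
  have hmeas : Measurable fun u : ℕ → X × ℤˣ =>
      ENNReal.ofReal (Real.cosh (θ * ‖sgd φ lam γ g₁ u (n + 1) - gl‖)) :=
    (Real.measurable_cosh.comp
      ((hP.measurable_norm_sgd_sub lam γ g₁ gl _).const_mul θ)).ennreal_ofReal
  rw [lintegral_infinitePi_update (fun _ => ρ) (n + 1) hmeas,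
    ← lintegral_mul_const' _ _ ENNReal.ofReal_ne_top]
  refine lintegral_mono fun u => ?_
  simp_rw [hstep, ← ENNReal.ofReal_mul (Real.cosh_pos _).le]
  exact hP.lintegral_cosh_step_le hη0 hηL hθ hgl _

theorem lintegral_cosh_sgd_le (hP : SmoothProblem H φ ρ M L R) (hlam : 0 < lam) (hγ : 0 < γ)
    (hη : stepSize lam γ 1 ≤ 1 / (L + lam)) (hgl : gradient (riskH φ ρ) gl + lam • gl = 0) (g₁ : H)
    (n : ℕ) {θ : ℝ} (hθ : 0 ≤ θ) :
    ∫⁻ u, ENNReal.ofReal (Real.cosh (θ * ‖sgd φ lam γ g₁ u n - gl‖))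
        ∂Measure.infinitePi (fun _ : ℕ => ρ)
      ≤ ENNReal.ofReal (Real.cosh (θ * (γ / (γ + n) * ‖g₁ - gl‖))
          * Real.exp (θ ^ 2 * ((4 * M * R / lam) ^ 2 / (γ + n)) / 2)) := by
  induction n generalizing θ with
  | zero =>
    simp only [sgd, lintegral_const, measure_univ, mul_one, Nat.cast_zero, add_zero,
      div_self hγ.ne', one_mul]
    gcongr
    exact le_mul_of_one_le_right (Real.cosh_pos _).le (Real.one_le_exp (by positivity))
  | succ n ih =>
    have hN : 1 ≤ γ + n := (one_lt_of_stepSize_one_le hP.L_pos hlam hγ.le hη).le.trans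
      (le_add_of_nonneg_right n.cast_nonneg)
    set q := 1 - stepSize lam γ (n + 1) * lam with hq
    rw [one_sub_stepSize_succ_mul hlam hγ.le] at hq
    have hq0 : 0 ≤ q := hq ▸ div_nonneg (sub_nonneg.2 hN) (by positivity)
    have hbias : q * (γ / (γ + n)) ≤ γ / (γ + (n + 1 : ℕ)) := by
      rw [hq, Nat.cast_add_one, ← add_assoc]
      exact contraction_mul_bias_le hN hγ.le
    have hvariance : q ^ 2 * ((4 * M * R / lam) ^ 2 / (γ + n))
        + (stepSize lam γ (n + 1) * (2 * M * R)) ^ 2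
          ≤ (4 * M * R / lam) ^ 2 / (γ + (n + 1 : ℕ)) := by
      rw [hq, stepSize_succ_mul hlam hγ.le, Nat.cast_add_one, ← add_assoc,
        show 2 * (2 * M * R) = 4 * M * R by ring]
      exact contraction_sq_mul_variance_add_le hN _
    calc _ ≤ _ := hP.lintegral_cosh_sgd_succ_le hlam hγ.le hη hgl g₁ n hθ
      _ ≤ ENNReal.ofReal (Real.cosh (θ * q * (γ / (γ + n) * ‖g₁ - gl‖))
            * Real.exp ((θ * q) ^ 2 * ((4 * M * R / lam) ^ 2 / (γ + n)) / 2))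
          * ENNReal.ofReal
            (Real.exp (θ ^ 2 * (stepSize lam γ (n + 1) * (2 * M * R)) ^ 2 / 2)) := by
        gcongr
        exact ih (mul_nonneg hθ hq0)
      _ ≤ _ := by
        rw [← ENNReal.ofReal_mul (by positivity), mul_assoc (Real.cosh _), ← Real.exp_add,
          mul_pow, mul_assoc, mul_assoc, ← add_div, ← mul_add, ← mul_assoc q]
        gcongr
        rw [Real.cosh_le_cosh, abs_of_nonneg (by positivity), abs_of_nonneg (by positivity)]
        gcongr

end SmoothProblem

section Link

variable {φ : ℝ → ℝ} {μ δ : ℝ}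

theorem isCondMin_link (hlink : LinkWellDefined φ) (hμ : μ ∈ Ioo (0 : ℝ) 1) :
    IsCondMin φ μ (link φ μ) :=
  Classical.epsilon_spec (hlink μ hμ).exists

theorem condRisk_one_sub_neg (φ : ℝ → ℝ) (μ h : ℝ) :
    condRisk φ (1 - μ) (-h) = condRisk φ μ h := by
  rw [condRisk, condRisk, neg_neg]; ring

theorem link_one_sub (hlink : LinkWellDefined φ) (hμ : μ ∈ Ioo (0 : ℝ) 1) :
    link φ (1 - μ) = -link φ μ := by
  have hμ' : 1 - μ ∈ Ioo (0 : ℝ) 1 := ⟨by linarith [hμ.2], by linarith [hμ.1]⟩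
  refine (hlink _ hμ').unique (isCondMin_link hlink hμ') fun h' => ?_
  rw [condRisk_one_sub_neg, ← neg_neg h', condRisk_one_sub_neg]
  exact isCondMin_link hlink hμ _

theorem half_add_mem_Ioo (hδ : δ ∈ Ioo (0 : ℝ) (1 / 2)) : 1 / 2 + δ ∈ Ioo (0 : ℝ) 1 :=
  ⟨by linarith [hδ.1], by linarith [hδ.2]⟩

theorem margin_eq (hlink : LinkWellDefined φ) (hδ : δ ∈ Ioo (0 : ℝ) (1 / 2)) :
    margin φ δ = |link φ (1 / 2 + δ)| := by
  have hsymm := link_one_sub hlink (half_add_mem_Ioo hδ)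
  rw [show (1 : ℝ) - (1 / 2 + δ) = 1 / 2 - δ by ring] at hsymm
  rw [margin, hsymm, abs_neg, max_eq_right (le_abs_self _)]

theorem link_half_add_pos (hδ : δ ∈ Ioo (0 : ℝ) (1 / 2))
    (hsign : ∀ μ ∈ Ioo (0 : ℝ) 1, Real.sign (μ - 1 / 2) = Real.sign (link φ μ)) :
    0 < link φ (1 / 2 + δ) := by
  have h := hsign (1 / 2 + δ) (half_add_mem_Ioo hδ)
  rw [add_sub_cancel_left, Real.sign_of_pos hδ.1] at h
  by_contra! hle
  rcases hle.lt_or_eq with h0 | h0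
  · rw [Real.sign_of_neg h0] at h
    norm_num at h
  · rw [h0, Real.sign_zero] at h
    norm_num at h

theorem margin_pos (hδ : δ ∈ Ioo (0 : ℝ) (1 / 2))
    (hsign : ∀ μ ∈ Ioo (0 : ℝ) 1, Real.sign (μ - 1 / 2) = Real.sign (link φ μ)) :
    0 < margin φ δ :=
  (link_half_add_pos hδ hsign).trans_le (le_max_left _ _)

theorem sign_eq_of_abs_sub_link_lt (hlink : LinkWellDefined φ) (hδ : δ ∈ Ioo (0 : ℝ) (1 / 2))
    (hmono : MonotoneOn (link φ) (Ioo 0 1))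
    (hsign : ∀ μ ∈ Ioo (0 : ℝ) 1, Real.sign (μ - 1 / 2) = Real.sign (link φ μ))
    (hμ : μ ∈ Ioo (0 : ℝ) 1) (hδμ : δ < |μ - 1 / 2|) {h : ℝ} (hh : |h - link φ μ| < margin φ δ) :
    Real.sign h = Real.sign (2 * μ - 1) := by
  have hplus := half_add_mem_Ioo hδ
  have hδ0 := hδ.1
  rw [margin_eq hlink hδ, abs_of_pos (link_half_add_pos hδ hsign), abs_lt] at hh
  rcases lt_abs.1 hδμ with hgt | hlt
  · have hle : link φ (1 / 2 + δ) ≤ link φ μ := hmono hplus hμ (by linarith)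
    rw [Real.sign_of_pos (by linarith), Real.sign_of_pos (by linarith)]
  · have hminus : 1 - (1 / 2 + δ) ∈ Ioo (0 : ℝ) 1 := ⟨by linarith [hδ.2], by linarith⟩
    have hle : link φ μ ≤ link φ (1 - (1 / 2 + δ)) := hmono hμ hminus (by linarith)
    rw [link_one_sub hlink hplus] at hle
    rw [Real.sign_of_neg (by linarith), Real.sign_of_neg (by linarith)]

end Link

section Bayes

variable {X : Type*} [MeasurableSpace X] {φ : ℝ → ℝ} {ρ : Measure (X × ℤˣ)}

theorem measurable_condProb [IsFiniteMeasure ρ] : Measurable (condProb ρ) :=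
  (Kernel.measurable_coe ρ.condKernel (measurableSet_singleton 1)).ennreal_toReal

theorem measurable_condRisk_condProb [IsFiniteMeasure ρ] (hφ : Measurable φ) {f : X → ℝ}
    (hf : Measurable f) : Measurable fun x => condRisk φ (condProb ρ x) (f x) :=
  (measurable_condProb.mul (hφ.comp hf)).add
    ((measurable_const.sub measurable_condProb).mul (hφ.comp hf.neg))

theorem IsBayesRule.lintegral_loss_ne_top {g : X → ℝ} (hg : IsBayesRule φ ρ g) :
    ∫⁻ z, ENNReal.ofReal (loss φ (g z.1) z.2) ∂ρ ≠ ⊤ :=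
  hg.2.1.lintegral_lt_top.ne

theorem IsBayesRule.lintegral_loss_le {g : X → ℝ} (hg : IsBayesRule φ ρ g) (hφ : Measurable φ)
    (hnonneg : ∀ v, 0 ≤ φ v) {f : X → ℝ} (hf : Measurable f) :
    ∫⁻ z, ENNReal.ofReal (loss φ (g z.1) z.2) ∂ρ
      ≤ ∫⁻ z, ENNReal.ofReal (loss φ (f z.1) z.2) ∂ρ := by
  have hpos : ∀ f : X → ℝ, 0 ≤ᵐ[ρ] fun z : X × ℤˣ => loss φ (f z.1) z.2 := fun f =>
    ae_of_all _ fun z => hnonneg _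
  rcases eq_or_ne (∫⁻ z, ENNReal.ofReal (loss φ (f z.1) z.2) ∂ρ) ⊤ with htop | hfin
  · exact htop ▸ le_top
  have hmeas : AEStronglyMeasurable (fun z : X × ℤˣ => loss φ (f z.1) z.2) ρ :=
    ((measurable_loss hφ).comp
      ((hf.comp measurable_fst).prodMk measurable_snd)).aestronglyMeasurable
  have hfRisk : FiniteRisk φ ρ f :=
    ⟨hmeas, (hasFiniteIntegral_iff_ofReal (hpos f)).2 hfin.lt_top⟩
  have hle := hg.2.2 f hf hfRisk
  rw [risk, risk, integral_eq_lintegral_of_nonneg_ae (hpos g) hg.2.1.aestronglyMeasurable,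
    integral_eq_lintegral_of_nonneg_ae (hpos f) hmeas] at hle
  exact (ENNReal.toReal_le_toReal hg.lintegral_loss_ne_top hfin).1 hle

theorem condProb_nonneg [IsFiniteMeasure ρ] (x : X) : 0 ≤ condProb ρ x :=
  measureReal_nonneg

variable [IsProbabilityMeasure ρ]

theorem condProb_le_one (x : X) : condProb ρ x ≤ 1 :=
  measureReal_le_one

theorem condRisk_condProb_nonneg (hφ : ∀ v, 0 ≤ φ v) (x : X) (h : ℝ) :
    0 ≤ condRisk φ (condProb ρ x) h :=
  add_nonneg (mul_nonneg (condProb_nonneg x) (hφ _))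
    (mul_nonneg (sub_nonneg.2 (condProb_le_one x)) (hφ _))

theorem condKernel_singleton_neg_one (x : X) :
    ρ.condKernel x {-1} = ENNReal.ofReal (1 - condProb ρ x) := by
  have hcompl : ({-1} : Set ℤˣ) = {1}ᶜ := by
    ext y
    rcases Int.units_eq_one_or y with rfl | rfl <;> simp
  rw [hcompl, ← ofReal_measureReal, probReal_compl_eq_one_sub (measurableSet_singleton _), condProb]

theorem lintegral_loss_eq (hφ : Measurable φ) (hnonneg : ∀ v, 0 ≤ φ v) {f : X → ℝ}
    (hf : Measurable f) :
    ∫⁻ z, ENNReal.ofReal (loss φ (f z.1) z.2) ∂ρ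
      = ∫⁻ x, ENNReal.ofReal (condRisk φ (condProb ρ x) (f x)) ∂ρ.fst := by
  have hmeas : Measurable fun z : X × ℤˣ => ENNReal.ofReal (loss φ (f z.1) z.2) :=
    ((measurable_loss hφ).comp ((hf.comp measurable_fst).prodMk measurable_snd)).ennreal_ofReal
  rw [← Measure.lintegral_condKernel hmeas]
  refine lintegral_congr fun x => ?_
  have huniv : (Finset.univ : Finset ℤˣ) = {1, -1} := rfl
  rw [lintegral_fintype, huniv, Finset.sum_pair (by decide), condKernel_singleton_neg_one,
    ← ofReal_measureReal (s := {1}), ← condProb]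
  simp only [loss, lab, Units.val_one, Units.val_neg, Int.cast_one, Int.cast_neg, one_mul, neg_mul]
  rw [← ENNReal.ofReal_mul (hnonneg _), ← ENNReal.ofReal_mul (hnonneg _), ← ENNReal.ofReal_add
    (mul_nonneg (hnonneg _) (condProb_nonneg x))
    (mul_nonneg (hnonneg _) (sub_nonneg.2 (condProb_le_one x))), condRisk, mul_comm,
    mul_comm (φ (-f x))]

namespace IsBayesRule

variable {g : X → ℝ}

theorem ae_condRisk_le (hg : IsBayesRule φ ρ g) (hφ : Measurable φ) (hnonneg : ∀ v, 0 ≤ φ v)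
    {f : X → ℝ} (hf : Measurable f) :
    ∀ᵐ x ∂ρ.fst, condRisk φ (condProb ρ x) (g x) ≤ condRisk φ (condProb ρ x) (f x) := by
  classical
  set s := {x | condRisk φ (condProb ρ x) (f x) < condRisk φ (condProb ρ x) (g x)}
  have hs : MeasurableSet s :=
    measurableSet_lt (measurable_condRisk_condProb hφ hf) (measurable_condRisk_condProb hφ hg.1)
  have hmeas : Measurable (s.piecewise f g) := hf.piecewise hs hg.1
  have himprove : ∀ x, ENNReal.ofReal (condRisk φ (condProb ρ x) (s.piecewise f g x))
      ≤ ENNReal.ofReal (condRisk φ (condProb ρ x) (g x)) := fun x => by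
    by_cases hx : x ∈ s
    · rw [piecewise_eq_of_mem _ _ _ hx]
      exact ENNReal.ofReal_le_ofReal (le_of_lt hx)
    · rw [piecewise_eq_of_notMem _ _ _ hx]
  have hoptimal := hg.lintegral_loss_le hφ hnonneg hmeas
  have hfin := hg.lintegral_loss_ne_top
  rw [lintegral_loss_eq hφ hnonneg hg.1] at hoptimal hfin
  rw [lintegral_loss_eq hφ hnonneg hmeas] at hoptimal
  have heq := ae_eq_of_ae_le_of_lintegral_le (ae_of_all _ himprove)
    ((lintegral_mono himprove).trans_lt hfin.lt_top).ne
    (measurable_condRisk_condProb hφ hg.1).ennreal_ofReal.aemeasurable hoptimal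
  filter_upwards [heq] with x hx
  by_contra! hlt
  rw [piecewise_eq_of_mem s f g hlt, ENNReal.ofReal_eq_ofReal_iff
    (condRisk_condProb_nonneg hnonneg x _) (condRisk_condProb_nonneg hnonneg x _)] at hx
  exact hlt.ne hx

theorem ae_isCondMin (hg : IsBayesRule φ ρ g) (hφ : Continuous φ) (hnonneg : ∀ v, 0 ≤ φ v) :
    ∀ᵐ x ∂ρ.fst, IsCondMin φ (condProb ρ x) (g x) := by
  have hrat : ∀ᵐ x ∂ρ.fst, ∀ q : ℚ,
      condRisk φ (condProb ρ x) (g x) ≤ condRisk φ (condProb ρ x) q :=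
    ae_all_iff.2 fun q => hg.ae_condRisk_le hφ.measurable hnonneg measurable_const
  filter_upwards [hrat] with x hx
  have hcont : Continuous (condRisk φ (condProb ρ x)) := by unfold condRisk; fun_prop
  exact fun h => Rat.isDenseEmbedding_coe_real.dense.induction_on (p := fun h =>
    condRisk φ (condProb ρ x) (g x) ≤ condRisk φ (condProb ρ x) h) h
    (isClosed_le continuous_const hcont) hx

theorem ae_eq_link (hg : IsBayesRule φ ρ g) (hφ : Continuous φ) (hnonneg : ∀ v, 0 ≤ φ v)
    (hlink : LinkWellDefined φ) (hprob : ∀ᵐ x ∂ρ.fst, condProb ρ x ∈ Ioo (0 : ℝ) 1) :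
    ∀ᵐ x ∂ρ.fst, g x = link φ (condProb ρ x) := by
  filter_upwards [hg.ae_isCondMin hφ hnonneg, hprob] with x hx hx01
  exact (hlink _ hx01).unique hx (isCondMin_link hlink hx01)

end IsBayesRule

end Bayes

section Classification

variable {X : Type*} [MeasurableSpace X] {ρ : Measure (X × ℤˣ)}

theorem zeroOne_nonneg (a b : ℝ) : 0 ≤ zeroOne a b := by
  rw [zeroOne]; split_ifs <;> norm_num

theorem zeroOne_le_one (a b : ℝ) : zeroOne a b ≤ 1 := by
  rw [zeroOne]; split_ifs <;> norm_num

theorem measurable_real_sign : Measurable Real.sign :=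
  Measurable.ite measurableSet_Iio measurable_const
    (Measurable.ite measurableSet_Ioi measurable_const measurable_const)

theorem measurable_zeroOne {A : Type*} [MeasurableSpace A] {f g : A → ℝ} (hf : Measurable f)
    (hg : Measurable g) : Measurable fun a => zeroOne (f a) (g a) := by
  simp only [zeroOne]
  exact Measurable.ite (measurableSet_eq_fun hf hg) measurable_const measurable_const

theorem classError_congr {f g : X → ℝ} (h : ∀ᵐ x ∂ρ.fst, Real.sign (f x) = Real.sign (g x)) :
    classError ρ f = classError ρ g := by
  refine integral_congr_ae ?_
  filter_upwards [ae_of_ae_map measurable_fst.aemeasurable h] with z hz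
  rw [hz]

theorem classError_nonneg (f : X → ℝ) : 0 ≤ classError ρ f :=
  integral_nonneg fun _ => zeroOne_nonneg _ _

theorem classError_le_one [IsProbabilityMeasure ρ] (f : X → ℝ) : classError ρ f ≤ 1 := by
  simpa [classError] using integral_mono_of_nonneg (μ := ρ)
    (ae_of_all _ fun _ => zeroOne_nonneg _ _) (integrable_const 1)
    (ae_of_all _ fun z => zeroOne_le_one (Real.sign (f z.1)) (lab z.2))

theorem measurable_classError [SFinite ρ] {A : Type*} [MeasurableSpace A] {G : A → X → ℝ}
    (hG : Measurable fun p : A × X => G p.1 p.2) : Measurable fun a => classError ρ (G a) := by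
  have hmeas : Measurable fun p : A × (X × ℤˣ) =>
      zeroOne (Real.sign (G p.1 p.2.1)) (lab p.2.2) :=
    measurable_zeroOne (measurable_real_sign.comp (hG.comp
      (measurable_fst.prodMk measurable_snd.fst)))
      ((measurable_of_countable lab).comp measurable_snd.snd)
  exact (hmeas.stronglyMeasurable.integral_prod_right (ν := ρ)).measurable

variable [IsProbabilityMeasure ρ] {A : Type*} [MeasurableSpace A] {P : Measure A}
  {G : A → X → ℝ}

theorem integrable_classError [IsFiniteMeasure P] (hG : Measurable fun p : A × X => G p.1 p.2) :
    Integrable (fun a => classError ρ (G a)) P :=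
  .of_bound (measurable_classError hG).aestronglyMeasurable 1 (ae_of_all _ fun a => by
    rw [Real.norm_eq_abs, abs_of_nonneg (classError_nonneg _)]
    exact classError_le_one _)

theorem integral_classError_sub_le [IsFiniteMeasure P]
    (hG : Measurable fun p : A × X => G p.1 p.2) {s : Set A} (hs : MeasurableSet s) {f : X → ℝ}
    (heq : ∀ a ∉ s, classError ρ (G a) = classError ρ f) :
    ∫ a, (classError ρ (G a) - classError ρ f) ∂P ≤ P.real s := by
  rw [← integral_indicator_one hs]
  refine integral_mono ((integrable_classError hG).sub (integrable_const _))
    ((integrable_const _).indicator hs) fun a => ?_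
  by_cases ha : a ∈ s
  · rw [indicator_of_mem ha, Pi.one_apply]
    linarith [classError_le_one (ρ := ρ) (G a), classError_nonneg (ρ := ρ) f]
  · rw [indicator_of_notMem ha, heq a ha, sub_self]

theorem classError_eq_classError_bayesClassifier {φ : ℝ → ℝ} {δ : ℝ} (hlink : LinkWellDefined φ)
    (hδ : δ ∈ Ioo (0 : ℝ) (1 / 2)) (hmono : MonotoneOn (link φ) (Ioo 0 1))
    (hsign : ∀ μ ∈ Ioo (0 : ℝ) 1, Real.sign (μ - 1 / 2) = Real.sign (link φ μ))
    (hprob : ∀ᵐ x ∂ρ.fst, condProb ρ x ∈ Ioo (0 : ℝ) 1)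
    (hnoise : ∀ᵐ x ∂ρ.fst, δ < |condProb ρ x - 1 / 2|) {f : X → ℝ}
    (hf : ∀ᵐ x ∂ρ.fst, |f x - link φ (condProb ρ x)| < margin φ δ) :
    classError ρ f = classError ρ (bayesClassifier ρ) := by
  refine classError_congr ?_
  filter_upwards [hf, hprob, hnoise] with x hx hx01 hxδ
  exact sign_eq_of_abs_sub_link_lt hlink hδ hmono hsign hx01 hxδ hx

end Classification

section Rate

open Filter Topology

variable {X : Type*} [MeasurableSpace X] {H : Type*} [NormedAddCommGroup H]
  [InnerProductSpace ℝ H] [CompleteSpace H] [RKHS ℝ H X ℝ]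
  {φ : ℝ → ℝ} {ρ : Measure (X × ℤˣ)} {M L R lam γ : ℝ}

theorem bias_le_half {N D r : ℝ} (hγ : 0 < γ) (hγN : γ ≤ N) (hr : 0 ≤ r)
    (h : 4 * (1 + γ) * D ^ 2 ≤ N * r ^ 2) : γ / N * D ≤ r / 2 := by
  have hN : 0 < N := hγ.trans_le hγN
  have hsq : (2 * γ * D) ^ 2 ≤ (r * N) ^ 2 := by
    calc (2 * γ * D) ^ 2 = γ * (4 * γ * D ^ 2) := by ring
      _ ≤ γ * (4 * (1 + γ) * D ^ 2) := by
        gcongr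
        exact le_add_of_nonneg_left zero_le_one
      _ ≤ N * (N * r ^ 2) := by gcongr
      _ = (r * N) ^ 2 := by ring
  have hle : 2 * γ * D ≤ r * N := le_of_sq_le_sq hsq (by positivity)
  rw [div_mul_eq_mul_div, div_le_div_iff₀ hN two_pos]
  linarith

omit [CompleteSpace H] in
theorem bias_le_half_of_threshold_le {g₁ gl : H} (hgl : IsRegularizedMin (riskH φ ρ) lam gl)
    (hlam : 0 < lam) (hγ : 0 < γ) (hR : 0 < R) {m T : ℝ} (hm : 0 < m) (hT : 0 ≤ T)
    (hle : 32 * R ^ 2 * ((1 + γ) * (regRisk φ ρ lam g₁ - regRisk φ ρ lam gl)) / (m ^ 2 * lam) - γ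
      ≤ T) : γ / (γ + T) * ‖g₁ - gl‖ ≤ m / (2 * R) / 2 := by
  have hgrowth : lam / 2 * ‖g₁ - gl‖ ^ 2 ≤ regRisk φ ρ lam g₁ - regRisk φ ρ lam gl := by
    rw [regRisk, regRisk]
    linarith [hgl g₁]
  have hbudget : 32 * R ^ 2 * ((1 + γ) * (lam / 2 * ‖g₁ - gl‖ ^ 2)) ≤ (γ + T) * (m ^ 2 * lam) := by
    rw [sub_le_iff_le_add', div_le_iff₀ (by positivity)] at hle
    exact le_trans (by gcongr) hle
  refine bias_le_half hγ (le_add_of_nonneg_right hT) (by positivity) ?_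
  rw [div_pow, mul_div_assoc', le_div_iff₀ (by positivity)]
  refine le_of_mul_le_mul_right ?_ hlam
  linarith

variable [IsProbabilityMeasure ρ]

theorem SmoothProblem.measureReal_norm_sgd_sub_ge_le (hP : SmoothProblem H φ ρ M L R)
    (hlam : 0 < lam) (hγ : 0 < γ) (hη : stepSize lam γ 1 ≤ 1 / (L + lam)) {gl : H}
    (hgl : gradient (riskH φ ρ) gl + lam • gl = 0) (g₁ : H) (n : ℕ) {r : ℝ} (hr : 0 < r)
    (hbias : γ / (γ + n) * ‖g₁ - gl‖ ≤ r / 2) :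
    (Measure.infinitePi fun _ : ℕ => ρ).real {u | r ≤ ‖sgd φ lam γ g₁ u n - gl‖}
      ≤ 2 * Real.exp (-(r ^ 2 * lam ^ 2 * (γ + n) / (2 ^ 7 * M ^ 2 * R ^ 2))) := by
  have hM := hP.M_pos
  have hR := hP.R_pos
  have hhalf : r / 2 ≤ r - γ / (γ + n) * ‖g₁ - gl‖ := by linarith
  have htail := measureReal_ge_le_of_lintegral_cosh_le (μ := Measure.infinitePi fun _ : ℕ => ρ)
    (hP.measurable_norm_sgd_sub lam γ g₁ gl n).aemeasurable
    (by positivity : 0 ≤ γ / (γ + n) * ‖g₁ - gl‖) (hbias.trans (half_le_self hr.le))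
    (by positivity : 0 < (4 * M * R / lam) ^ 2 / (γ + n))
    fun θ hθ => hP.lintegral_cosh_sgd_le hlam hγ hη hgl g₁ n hθ
  refine htail.trans (mul_le_mul_of_nonneg_left (Real.exp_le_exp.2 (neg_le_neg ?_)) two_pos.le)
  calc r ^ 2 * lam ^ 2 * (γ + n) / (2 ^ 7 * M ^ 2 * R ^ 2)
      = (r / 2) ^ 2 / (2 * ((4 * M * R / lam) ^ 2 / (γ + n))) := by
        field_simp
        norm_num
    _ ≤ _ := by gcongr

theorem SmoothProblem.integral_classError_sgd_sub_le (hP : SmoothProblem H φ ρ M L R)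
    (hlam : 0 < lam) (hγ : 0 < γ) (hη : stepSize lam γ 1 ≤ 1 / (L + lam)) {gl : H}
    (hgl : gradient (riskH φ ρ) gl + lam • gl = 0) {r : ℝ} (hr : 0 < r) {f : X → ℝ}
    (hclass : ∀ g : H, ‖g - gl‖ < r → classError ρ g = classError ρ f) (g₁ : H) (n : ℕ)
    (hbias : γ / (γ + n) * ‖g₁ - gl‖ ≤ r / 2) :
    ∫ u, (classError ρ (sgd φ lam γ g₁ u n : H) - classError ρ f)
        ∂Measure.infinitePi (fun _ : ℕ => ρ)
      ≤ 2 * Real.exp (-(r ^ 2 * lam ^ 2 * (γ + n) / (2 ^ 7 * M ^ 2 * R ^ 2))) :=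
  (integral_classError_sub_le
    (weaklyMeasurable_sgd hP.measurable_ker hP.differentiable lam γ g₁ n).eval
    (measurableSet_le measurable_const (hP.measurable_norm_sgd_sub lam γ g₁ gl n))
    fun _ hu => hclass _ (not_le.1 hu)).trans
  (hP.measureReal_norm_sgd_sub_ge_le hlam hγ hη hgl g₁ n hr hbias)

theorem SmoothProblem.exists_isBayesRule_tendsto (hP : SmoothProblem H φ ρ M L R) {gl : ℝ → H}
    (hgl : ∀ lam, 0 < lam → IsRegularizedMin (riskH φ ρ) lam (gl lam))
    (hbayes : ∃ gs : H, IsBayesRule φ ρ gs) :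
    ∃ g₀ : H, IsBayesRule φ ρ g₀ ∧ Tendsto gl (𝓝[>] 0) (𝓝 g₀) := by
  obtain ⟨gs, hgs⟩ := hbayes
  obtain ⟨g₀, hlim, hmin⟩ := hP.isSubgradientField.exists_tendsto_isRegularizedMin hgl
    fun g => hgs.2.2 g (hP.measurable_coe g) (hP.finiteRisk g)
  exact ⟨g₀, ⟨hP.measurable_coe g₀, hP.finiteRisk g₀,
    fun f hf hfin => (hmin gs).trans (hgs.2.2 f hf hfin)⟩, hlim⟩

theorem SmoothProblem.classError_eq_of_norm_sub_lt (hP : SmoothProblem H φ ρ M L R) {δ : ℝ}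
    (hδ : δ ∈ Ioo (0 : ℝ) (1 / 2)) (hnoise : ∀ᵐ x ∂ρ.fst, δ < |condProb ρ x - 1 / 2|)
    (hprob : ∀ᵐ x ∂ρ.fst, condProb ρ x ∈ Ioo (0 : ℝ) 1) (hlink : LinkWellDefined φ)
    (hmono : MonotoneOn (link φ) (Ioo 0 1))
    (hsign : ∀ μ ∈ Ioo (0 : ℝ) 1, Real.sign (μ - 1 / 2) = Real.sign (link φ μ)) {g₀ g : H}
    (hg₀ : IsBayesRule φ ρ g₀) (hg : ‖g - g₀‖ < margin φ δ / R) :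
    classError ρ g = classError ρ (bayesClassifier ρ) := by
  refine classError_eq_classError_bayesClassifier hlink hδ hmono hsign hprob hnoise ?_
  filter_upwards [hg₀.ae_eq_link hP.differentiable.continuous hP.nonneg hlink hprob] with x hx
  calc |g x - link φ (condProb ρ x)| = |(g - g₀ : H) x| := by
        rw [← hx, RKHS.coe_sub, Pi.sub_apply]
    _ ≤ R * ‖g - g₀‖ := abs_apply_le hP.R_pos.le hP.ker_le _ x
    _ < margin φ δ := (lt_div_iff₀' hP.R_pos).1 hg

theorem SmoothProblem.exists_forall_classError_eq (hP : SmoothProblem H φ ρ M L R) {δ : ℝ}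
    (hδ : δ ∈ Ioo (0 : ℝ) (1 / 2)) (hnoise : ∀ᵐ x ∂ρ.fst, δ < |condProb ρ x - 1 / 2|)
    (hprob : ∀ᵐ x ∂ρ.fst, condProb ρ x ∈ Ioo (0 : ℝ) 1) (hlink : LinkWellDefined φ)
    (hmono : MonotoneOn (link φ) (Ioo 0 1))
    (hsign : ∀ μ ∈ Ioo (0 : ℝ) 1, Real.sign (μ - 1 / 2) = Real.sign (link φ μ))
    (hbayes : ∃ gs : H, IsBayesRule φ ρ gs) {gl : ℝ → H}
    (hgl : ∀ lam, 0 < lam → IsRegularizedMin (riskH φ ρ) lam (gl lam)) :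
    ∃ lam₀ : ℝ, 0 < lam₀ ∧ ∀ lam : ℝ, 0 < lam → lam ≤ lam₀ →
      ∀ g : H, ‖g - gl lam‖ < margin φ δ / (2 * R) →
        classError ρ g = classError ρ (bayesClassifier ρ) := by
  have hR := hP.R_pos
  have hm := margin_pos hδ hsign
  obtain ⟨g₀, hg₀, hlim⟩ := hP.exists_isBayesRule_tendsto hgl hbayes
  obtain ⟨lam₀, hlam₀, hball⟩ := mem_nhdsGT_iff_exists_Ioc_subset.1
    (hlim.eventually (Metric.ball_mem_nhds g₀ (by positivity : 0 < margin φ δ / (2 * R))))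
  refine ⟨lam₀, hlam₀, fun lam hlam hle g hg =>
    hP.classError_eq_of_norm_sub_lt hδ hnoise hprob hlink hmono hsign hg₀ ?_⟩
  calc ‖g - g₀‖ ≤ ‖g - gl lam‖ + ‖gl lam - g₀‖ := norm_sub_le_norm_sub_add_norm_sub _ _ _
    _ < margin φ δ / (2 * R) + margin φ δ / (2 * R) :=
      add_lt_add hg (mem_ball_iff_norm.1 (hball ⟨hlam, hle⟩))
    _ = margin φ δ / R := by
      field_simp
      norm_num

end Rate

end KernelSGD

open KernelSGD in
theorem theorem1_general {X : Type*} [MeasurableSpace X] {H : Type*} [NormedAddCommGroup H]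
    [InnerProductSpace ℝ H] [CompleteSpace H] [RKHS ℝ H X ℝ] {φ : ℝ → ℝ} {ρ : Measure (X × ℤˣ)}
    [IsProbabilityMeasure ρ] {M L R δ : ℝ} (hP : SmoothProblem H φ ρ M L R)
    (hδ : δ ∈ Ioo (0 : ℝ) (1 / 2)) (hnoise : ∀ᵐ x ∂ρ.fst, δ < |condProb ρ x - 1 / 2|)
    (hprob : ∀ᵐ x ∂ρ.fst, condProb ρ x ∈ Ioo (0 : ℝ) 1) (hlink : LinkWellDefined φ)
    (hmono : MonotoneOn (link φ) (Ioo 0 1))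
    (hsign : ∀ μ ∈ Ioo (0 : ℝ) 1, Real.sign (μ - 1 / 2) = Real.sign (link φ μ))
    (hbayes : ∃ gs : H, IsBayesRule φ ρ gs) :
    ∃ lam₀ : ℝ, 0 < lam₀ ∧ ∀ lam : ℝ, 0 < lam → lam ≤ lam₀ →
      ∃ gl : H, (∀ g : H, regRisk φ ρ lam gl ≤ regRisk φ ρ lam g) ∧
      ∀ (γ : ℝ) (g₁ : H), 0 < γ → stepSize lam γ 1 ≤ 1 / (L + lam) →
      ∀ (Ω : Type*) [MeasurableSpace Ω] (P : Measure Ω) [IsProbabilityMeasure P]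
        (Z : ℕ → Ω → X × ℤˣ), (∀ t, HasLaw (Z t) ρ P) → iIndepFun Z P →
      ∀ T : ℕ,
        32 * R ^ 2 * ((1 + γ) * (regRisk φ ρ lam g₁ - regRisk φ ρ lam gl))
            / (margin φ δ ^ 2 * lam) - γ ≤ T →
        Integrable (fun ω => classError ρ (sgd φ lam γ g₁ (fun t => Z t ω) T : H)) P ∧
        ∫ ω, (classError ρ (sgd φ lam γ g₁ (fun t => Z t ω) T : H)
            - classError ρ (bayesClassifier ρ)) ∂P
          ≤ 2 * Real.exp (-(margin φ δ ^ 2 * lam ^ 2 * (γ + T) / (2 ^ 9 * M ^ 2 * R ^ 4))) := by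
  choose! gl hgl using fun (lam : ℝ) (hlam : 0 < lam) =>
    hP.isSubgradientField.exists_add_smul_eq_zero hP.smooth hP.L_pos hlam
  have hmin := fun lam hlam => hP.isSubgradientField.isRegularizedMin (hgl lam hlam)
  obtain ⟨lam₀, hlam₀, hclass⟩ :=
    hP.exists_forall_classError_eq hδ hnoise hprob hlink hmono hsign hbayes hmin
  refine ⟨lam₀, hlam₀, fun lam hlam hle => ⟨gl lam, (hmin lam hlam).le hlam.le, ?_⟩⟩
  intro γ g₁ hγ hη Ω _ P _ Z hlaw hind T hT
  have hR := hP.R_pos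
  have hm := margin_pos hδ hsign
  have hZ : HasLaw (fun ω t => Z t ω) (Measure.infinitePi fun _ => ρ) P :=
    hind.hasLaw_infinitePi hlaw (aemeasurable_pi_iff.2 fun t => (hlaw t).aemeasurable)
  have hint : Integrable (fun u => classError ρ (sgd φ lam γ g₁ u T : H))
      (Measure.infinitePi fun _ : ℕ => ρ) := integrable_classError
    (weaklyMeasurable_sgd hP.measurable_ker hP.differentiable lam γ g₁ T).eval
  refine ⟨(hZ.map_eq ▸ hint).comp_aemeasurable hZ.aemeasurable, ?_⟩
  calc _ = _ := hZ.integral_comp (hint.sub (integrable_const _)).aestronglyMeasurable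
    _ ≤ _ := hP.integral_classError_sgd_sub_le hlam hγ hη (hgl lam hlam) (by positivity)
      (hclass lam hlam hle) g₁ T
      (bias_le_half_of_threshold_le (hmin lam hlam) hlam hγ hR hm T.cast_nonneg hT)
    _ = _ := by
      congr 3
      field_simp

theorem theorem1
    {X : Type*} [TopologicalSpace X] [MeasurableSpace X] [OpensMeasurableSpace X]
    (ρ : Measure (X × ℤˣ)) [IsProbabilityMeasure ρ]
    (H : Type*) [NormedAddCommGroup H] [InnerProductSpace ℝ H] [CompleteSpace H] [RKHS ℝ H X ℝ]
    (hker : Measurable fun p : X × X => KernelSGD.ker H p.1 p.2)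
    (φ : ℝ → ℝ) (hφ_nonneg : ∀ v, 0 ≤ φ v) (M L R δ : ℝ)
    -- (A1)
    (hφ_diff : Differentiable ℝ φ) (hφ_conv : ConvexOn ℝ univ φ)
    (hM : 0 < M) (hφ_bdd : ∀ (ζ : ℝ) (y : ℤˣ), |KernelSGD.lossDeriv φ ζ y| ≤ M)
    (hL : 0 < L)
    (hL_smooth : ∀ g h : H,
      |KernelSGD.riskH φ ρ (g + h) - KernelSGD.riskH φ ρ g
        - ⟪gradient (KernelSGD.riskH φ ρ) g, h⟫_ℝ| ≤ L / 2 * ‖h‖ ^ 2)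
    -- (A2)
    (hsupp : ρ.fst.support = univ)
    (hR : 0 < R) (hker_bdd : ∀ x : X, KernelSGD.ker H x x ≤ R ^ 2)
    -- (A3)
    (hδ : δ ∈ Ioo (0 : ℝ) (1 / 2))
    (hnoise : ∀ᵐ x ∂ρ.fst, δ < |KernelSGD.condProb ρ x - 1 / 2|)
    -- (A4)
    (hprob : ∀ᵐ x ∂ρ.fst, KernelSGD.condProb ρ x ∈ Ioo (0 : ℝ) 1)
    (hlink : KernelSGD.LinkWellDefined φ)
    (hlink_diff : DifferentiableOn ℝ (KernelSGD.link φ) (Ioo 0 1))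
    (hlink_mono : MonotoneOn (KernelSGD.link φ) (Ioo 0 1))
    (hlink_inj : InjOn (KernelSGD.link φ) (Ioo 0 1))
    (hlink_sign : ∀ μ ∈ Ioo (0 : ℝ) 1,
      Real.sign (μ - 1 / 2) = Real.sign (KernelSGD.link φ μ))
    -- (A5)
    (hbreg : ∀ η₁ ∈ Ioo (0 : ℝ) 1, ∀ η₂ ∈ Ioo (0 : ℝ) 1,
      KernelSGD.bregman φ η₁ η₂ = 0 ↔ η₁ = η₂)
    (hbayes : ∃ gs : H, KernelSGD.IsBayesRule φ ρ gs ∧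
      ∀ f : X → ℝ, KernelSGD.IsBayesRule φ ρ f → f =ᵐ[ρ.fst] gs) :
    ∃ lam₀ : ℝ, 0 < lam₀ ∧ ∀ lam : ℝ, 0 < lam → lam ≤ lam₀ →
      -- the minimizer `g_λ` of the regularized risk
      ∃ gl : H, (∀ g : H, KernelSGD.regRisk φ ρ lam gl ≤ KernelSGD.regRisk φ ρ lam g) ∧
      ∀ (γ σ : ℝ) (g₁ : H), 0 < γ →
        KernelSGD.stepSize lam γ 1 ≤ min (1 / (L + lam)) (1 / (2 * lam)) →
        0 < σ → (∀ g : H, KernelSGD.gradVariance φ ρ g ≤ σ ^ 2) →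
        ‖g₁‖ ≤ (2 * KernelSGD.stepSize lam γ 1 + 1 / lam) * M * R →
      ∀ (Ω : Type*) [MeasurableSpace Ω] (P : Measure Ω) [IsProbabilityMeasure P]
        (Z : ℕ → Ω → X × ℤˣ), (∀ t, HasLaw (Z t) ρ P) → iIndepFun Z P →
      ∀ T : ℕ,
        32 * R ^ 2 * KernelSGD.nu φ ρ lam γ L σ g₁ gl / (KernelSGD.margin φ δ ^ 2 * lam) - γ ≤ T →
        Integrable (fun ω => KernelSGD.classError ρ
            (KernelSGD.sgd φ lam γ g₁ (fun t => Z t ω) T : H)) P ∧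
        ∫ ω, (KernelSGD.classError ρ (KernelSGD.sgd φ lam γ g₁ (fun t => Z t ω) T : H)
            - KernelSGD.classError ρ (KernelSGD.bayesClassifier ρ)) ∂P
          ≤ 2 * Real.exp (-(KernelSGD.margin φ δ ^ 2 * lam ^ 2 * (γ + T)
              / (2 ^ 9 * 9 * M ^ 2 * R ^ 4))) := by
  have hP : KernelSGD.SmoothProblem H φ ρ M L R :=
    ⟨hker, hφ_nonneg, hφ_diff, hφ_conv, hM, hφ_bdd, hL, .of_abs_le hL_smooth, hR, hker_bdd⟩
  obtain ⟨lam₀, hlam₀, hrate⟩ := theorem1_general hP hδ hnoise hprob hlink hlink_mono hlink_sign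
    (hbayes.imp fun _ => And.left)
  refine ⟨lam₀, hlam₀, fun lam hlam hle => ?_⟩
  obtain ⟨gl, hgl, hrate⟩ := hrate lam hlam hle
  refine ⟨gl, hgl, fun γ σ g₁ hγ hη _ _ _ Ω _ P _ Z hlaw hind T hT => ?_⟩
  have hT' : 32 * R ^ 2 * ((1 + γ) * (KernelSGD.regRisk φ ρ lam g₁ - KernelSGD.regRisk φ ρ lam gl))
      / (KernelSGD.margin φ δ ^ 2 * lam) - γ ≤ T :=
    le_trans (by gcongr; exact le_max_right _ _) hT
  refine (hrate γ g₁ hγ (hη.trans (min_le_left _ _)) Ω P Z hlaw hind T hT').imp_right fun h =>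
    h.trans ?_
  gcongr
  norm_num
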